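/- **Notation.** Let $q$ be a prime power. A linear $[n,n-r]_q$ code is an $(n-r)$-dimensional subspace of $\mathbb F_q^{\,n}$; its covering radius is the smallest integer $k$ such that every vector of $\mathbb F_q^{\,n}$ is within Hamming distance $k$ of a codeword. The length function $\ell_q(r,R)$ is the smallest $n$ for which there is a linear $[n,n-r]_q$ code with covering radius $R$. A set $S$ of points of $\mathrm{PG}(N,q)$ is $\rho$-saturating if every point of $\mathrm{PG}(N,q)$ is a linear combination of at most $\rho+1$ points of $S$ and $\rho$ is the smallest value with this property; $s_q(N,\rho)$ is the smallest size of such a set. Put $\theta_{m,q}=(q^{m+1}-1)/(q-1)$. For an integer $R\ge 3$, a real $\lambda>0$ and real $q>1$ put $$D^{\min}_R=\tfrac{R}{R-1}\sqrt[R]{R(R-1)\,R!},\qquad D_{\lambda,R}=\lambda+\frac{R\cdot R!}{\lambda^{R-1}},\qquad \beta_{\lambda,R}(q)=\lambda-\frac{R-1}{\sqrt[R]{q\ln q}},$$ $$\Upsilon_{\lambda,R}(q)=\frac{\lambda^{R-1}}{(R-1)!}\sqrt[R]{\frac{\ln^{R-1}q}{q}},\qquad \Omega_{\lambda,R}(q)=\lambda+\frac{R\cdot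 R!}{\beta_{\lambda,R}^{R-1}(q)}\cdot\frac{2}{2-\frac1q-\Upsilon_{\lambda,R}(q)}.$$ Let $Q_{\lambda,R}=\lceil x\rceil$, where $x=e^{R-1}$ if $\Upsilon_{\lambda,R}(e^{R-1})\le 1$, and otherwise $x$ is the unique solution $x>e^{R-1}$ of $\Upsilon_{\lambda,R}(x)=1$. Finally put $$C_{\lambda,R}=\lambda+\frac{R\cdot R!}{\beta_{\lambda,R}^{R-1}(Q_{\lambda,R})}\cdot\frac{2Q_{\lambda,R}}{Q_{\lambda,R}-1}.$$ **Theorem.** Fix an integer $R\ge3$. For every prime power $q$ and every $t\ge1$, with $r=tR+1$, both minima exist and $\ell_q(r,R)=s_q(r-1,R-1)$. Moreover the following hold, where $r=tR+1$ throughout. **(i)** Let $\lambda>0$ be such that $\beta_{\lambda,R}(Q_{\lambda,R})>0$. On the real numbers $q>Q_{\lambda,R}$ the function $\Omega_{\lambda,R}(q)$ is strictly decreasing and $\Omega_{\lambda,R}(q)<C_{\lambda,R}$. For every prime power $q>Q_{\lambda,R}$ and every $t\ge1$, where if $t\ge2$ it is also assumed that $C_{\lambda,R}\sqrt[R]{q\ln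 q}+2R\le q+1$, $$\ell_q(r,R)=s_q(r-1,R-1)<\Omega_{\lambda,R}(q)\,q^{(r-R)/R}\sqrt[R]{\ln q}+2Rq^{t-1}+R\theta_{t-1,q}<\Bigl(\Omega_{\lambda,R}(q)+R\,\frac{2+q/(q-1)}{\sqrt[R]{q\ln q}}\Bigr)q^{(r-R)/R}\sqrt[R]{\ln q}.$$ **(ii)** Let $\lambda>0$ be such that $\beta_{\lambda,R}(Q_{\lambda,R})>0$, and let $Q_0>Q_{\lambda,R}$ be real. Then $C_{\lambda,R}>\Omega_{\lambda,R}(Q_0)>D_{\lambda,R}$. Let $(c,q_0)$ be $(C_{\lambda,R},Q_{\lambda,R})$ or $(\Omega_{\lambda,R}(Q_0),Q_0)$. For every prime power $q>q_0$ and every $t\ge1$, where if $t\ge2$ it is also assumed that $c\sqrt[R]{q\ln q}+2R\le q+1$, $$\ell_q(r,R)=s_q(r-1,R-1)<c\,q^{(r-R)/R}\sqrt[R]{\ln q}+2Rq^{t-1}+R\theta_{t-1,q}<\Bigl(c+R\,\frac{2+q_0/(q_0-1)}{\sqrt[R]{q_0\ln q_0}}\Bigr)q^{(r-R)/R}\sqrt[R]{\ln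 q}.$$ **(iii)** Let $c=D^{\min}_R$, or $c=D_{\lambda,R}$ for some $\lambda>0$. There is $q_1$, depending only on $R$ and $c$, such that for every prime power $q>q_1$ and every $t\ge1$ $$\ell_q(r,R)=s_q(r-1,R-1)<c\,q^{(r-R)/R}\sqrt[R]{\ln q}+2Rq^{t-1}+R\theta_{t-1,q}<\Bigl(c+R\,\frac{2+q/(q-1)}{\sqrt[R]{q\ln q}}\Bigr)q^{(r-R)/R}\sqrt[R]{\ln q}.$$ There is also $q_1$, depending only on $R$, such that for every prime power $q>q_1$ and every $t\ge1$ $$\ell_q(r,R)=s_q(r-1,R-1)<3.43\,R\,q^{(r-R)/R}\sqrt[R]{\ln q}.$$ -/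

import Mathlib

universe u

noncomputable section

/-! Linear codes, covering radius and the length function. -/

open Classical in
/-- The subspace `C` of `F ^ n` has covering radius `R`: `R` is the smallest integer such that the
Hamming balls of radius `R` centred at the codewords cover `F ^ n`. -/
def HasCoveringRadius {F : Type u} [Field F] {n : ℕ} (C : Submodule F (Fin n → F)) (R : ℕ) :
    Prop :=
  IsLeast {k : ℕ | ∀ v : Fin n → F, ∃ c ∈ C, hammingDist v c ≤ k} R

/-- The set of all lengths `n` of linear `[n, n - r]` codes over `F` with covering radius `R`. -/
def codeLengths (F : Type u) [Field F] (r R : ℕ) : Set ℕ :=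
  {n : ℕ | ∃ C : Submodule F (Fin n → F), Module.finrank F C + r = n ∧ HasCoveringRadius C R}

/-- The length function `ℓ_q(r, R)`, where `F` is the field with `q` elements. -/
def lengthFunction (F : Type u) [Field F] (r R : ℕ) : ℕ :=
  sInf (codeLengths F r R)

/-! Saturating sets in projective spaces. -/

/-- The projective space `PG(N, q)` over the field `F` with `q` elements. -/
abbrev PG (F : Type u) [Field F] (N : ℕ) : Type u :=
  Projectivization F (Fin (N + 1) → F)

/-- The point `A` is a linear combination of at most `k` points of `S`. -/
def IsCombinationOfAtMost {F : Type u} [Field F] {N : ℕ} (S : Finset (PG F N)) (k : ℕ)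
    (A : PG F N) : Prop :=
  ∃ T : Finset (PG F N), T ⊆ S ∧ T.card ≤ k ∧ A.submodule ≤ ⨆ P ∈ T, P.submodule

/-- `S` is `ρ`-saturating: every point is a linear combination of at most `ρ + 1` points of `S`,
and `ρ` is the smallest value with this property. -/
def IsSaturating {F : Type u} [Field F] {N : ℕ} (S : Finset (PG F N)) (ρ : ℕ) : Prop :=
  IsLeast {k : ℕ | ∀ A : PG F N, IsCombinationOfAtMost S (k + 1) A} ρ

/-- The set of all sizes of `ρ`-saturating sets in `PG(N, q)`. -/
def saturatingSizes (F : Type u) [Field F] (N ρ : ℕ) : Set ℕ :=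
  {n : ℕ | ∃ S : Finset (PG F N), S.card = n ∧ IsSaturating S ρ}

/-- The smallest size `s_q(N, ρ)` of a `ρ`-saturating set in `PG(N, q)`. -/
def smallestSaturating (F : Type u) [Field F] (N ρ : ℕ) : ℕ :=
  sInf (saturatingSizes F N ρ)

/-! The constants and functions in the bounds. -/

/-- `θ_{m,q} = (q ^ (m + 1) - 1) / (q - 1)`. -/
def thetaPG (m : ℕ) (q : ℝ) : ℝ := (q ^ (m + 1) - 1) / (q - 1)

/-- The `R`-th root of `q ln q`. -/
def rootQLn (R : ℕ) (q : ℝ) : ℝ := (q * Real.log q) ^ (1 / (R : ℝ))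

/-- `D_R^min = R / (R - 1) * (R (R - 1) R!) ^ (1 / R)`. -/
def Dmin (R : ℕ) : ℝ :=
  (R : ℝ) / ((R : ℝ) - 1) * ((R : ℝ) * ((R : ℝ) - 1) * (R.factorial : ℝ)) ^ (1 / (R : ℝ))

/-- `D_{λ,R} = λ + R R! / λ ^ (R - 1)`. -/
def Dlam (lam : ℝ) (R : ℕ) : ℝ :=
  lam + (R : ℝ) * (R.factorial : ℝ) / lam ^ (R - 1)

/-- `β_{λ,R}(q) = λ - (R - 1) / (q ln q) ^ (1 / R)`. -/
def betaFn (lam : ℝ) (R : ℕ) (q : ℝ) : ℝ :=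
  lam - ((R : ℝ) - 1) / rootQLn R q

/-- `Υ_{λ,R}(q) = λ ^ (R - 1) / (R - 1)! * ((ln q) ^ (R - 1) / q) ^ (1 / R)`. -/
def upsilonFn (lam : ℝ) (R : ℕ) (q : ℝ) : ℝ :=
  lam ^ (R - 1) / ((R - 1).factorial : ℝ) * (Real.log q ^ (R - 1) / q) ^ (1 / (R : ℝ))

/-- `Ω_{λ,R}(q) = λ + R R! / β_{λ,R}(q) ^ (R - 1) * 2 / (2 - 1 / q - Υ_{λ,R}(q))`. -/
def omegaFn (lam : ℝ) (R : ℕ) (q : ℝ) : ℝ :=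
  lam + (R : ℝ) * (R.factorial : ℝ) / betaFn lam R q ^ (R - 1)
    * (2 / (2 - 1 / q - upsilonFn lam R q))

open Classical in
/-- The real number whose ceiling is `Q_{λ,R}`: it is `e ^ (R - 1)` if
`Υ_{λ,R}(e ^ (R - 1)) ≤ 1`, and otherwise the solution `y > e ^ (R - 1)` of `Υ_{λ,R}(y) = 1`.
That solution exists and is unique, because `Υ_{λ,R}` decreases strictly to `0` beyond
`e ^ (R - 1)`, so the set below is a singleton. -/
def preQ (lam : ℝ) (R : ℕ) : ℝ :=
  if upsilonFn lam R (Real.exp ((R : ℝ) - 1)) ≤ 1 then Real.exp ((R : ℝ) - 1)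
  else sInf {y : ℝ | Real.exp ((R : ℝ) - 1) < y ∧ upsilonFn lam R y = 1}

/-- `Q_{λ,R}`. -/
def Qlam (lam : ℝ) (R : ℕ) : ℕ := ⌈preQ lam R⌉₊

/-- `C_{λ,R} = λ + R R! / β_{λ,R}(Q) ^ (R - 1) * 2 Q / (Q - 1)`, where `Q = Q_{λ,R}`. -/
def Clam (lam : ℝ) (R : ℕ) : ℝ :=
  lam + (R : ℝ) * (R.factorial : ℝ) / betaFn lam R (Qlam lam R) ^ (R - 1)
    * (2 * (Qlam lam R : ℝ) / ((Qlam lam R : ℝ) - 1))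

/-- The main term `q ^ ((r - R) / R) * (ln q) ^ (1 / R)`. -/
def mainTerm (R r : ℕ) (q : ℝ) : ℝ :=
  q ^ (((r : ℝ) - (R : ℝ)) / (R : ℝ)) * Real.log q ^ (1 / (R : ℝ))

/-- `c q ^ ((r - R) / R) (ln q) ^ (1 / R) + 2 R q ^ (t - 1) + R θ_{t-1,q}`, where `r = t R + 1`. -/
def firstBound (R t : ℕ) (c q : ℝ) : ℝ :=
  c * mainTerm R (t * R + 1) q + 2 * (R : ℝ) * q ^ (t - 1) + (R : ℝ) * thetaPG (t - 1) q

/-- `(c + R (2 + a / (a - 1)) / (a ln a) ^ (1 / R)) q ^ ((r - R) / R) (ln q) ^ (1 / R)`,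
where `r = t R + 1`. -/
def secondBound (R t : ℕ) (c a q : ℝ) : ℝ :=
  (c + (R : ℝ) * ((2 + a / (a - 1)) / rootQLn R a)) * mainTerm R (t * R + 1) q

end

/-!
Everything is phrased through families of vectors `h : ι → V` such that every vector of `V` is a
combination of at most `R` members of `h` (`CoversWith`). The columns of a parity check matrix, and
representatives of the points of a saturating set, are such families.

*Exact radius.* Both minima ask for a covering radius of exactly `R`. Adding a multiple of one
member to another changes the covering radius by at most one, and by such steps a family can be
degenerated to a basis padded with zeros, whose radius is the dimension. Hence a family that covers
with `R` vectors can be replaced by one of the same size and radius exactly `R`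
(`CoversWith.exists_isLeast`). This gives existence and equality of the two minima, and reduces the
upper bounds to constructing families that cover.

*Codimension `R + 1`.* Write `L` for the `R`-th root of `q ln q`, and take `w = ⌊λ L⌋` points of the
rational normal curve in `F ^ (R + 1)`. A vector `B` outside the span of any `R` of them spans with
the `m = w.choose (R - 1)` different `(R - 1)`-subsets pairwise distinct hyperplanes, and by the
Bonferroni inequality these hyperplanes contain a proportion of about `(m / q) (1 - m / (2 q))` of
all vectors; adding any of these vectors to the family covers `B` (`card_extension_ge`). So a greedy
choice of vectors reduces the number of uncovered vectors geometrically (`exists_greedy`), and about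
`(R + 1) ln q / p` choices suffice, `p` being the proportion (`exists_coversWith_card_le`). Here `β`
enters through `m ≥ (β L) ^ (R - 1) / (R - 1)!`, and `Υ` through `m ≤ Υ q`. The resulting
coefficient of `L` has `(R + 1) (R - 1)!` where `Ω` has `R R!`; this slack is what makes the limit
value `D_{λ,R}` itself admissible for large `q`.

*Codimension `t R + 1`.* If the family has at most `q` members, one attaches to them distinct
scalars `β i` and forms the vectors `(h i, f, β i f, β i ^ 2 f, …)` with `f` in `F ^ (t - 1)`; a
Vandermonde system and few further vectors turn a combination in `F ^ (R + 1)` into one in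
`F ^ (t R + 1)` (`coversWith_concatFamily`).
-/

/-! ### Covering families of vectors -/

/-- Every vector of `V` is a linear combination of at most `k` members of the family `h`. When `h`
lists the columns of a parity check matrix this says that the code has covering radius at most `k`;
zero and repeated members are allowed. -/
def CoversWith (F : Type*) {ι V : Type*} [Field F] [AddCommGroup V] [Module F V] (h : ι → V)
    (k : ℕ) : Prop :=
  ∀ v : V, ∃ s : Finset ι, s.card ≤ k ∧ v ∈ Submodule.span F (h '' (s : Set ι))

section Covers

variable {F ι κ V W : Type*} [Field F] [AddCommGroup V] [Module F V] [AddCommGroup W] [Module F W]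

theorem CoversWith.mono {h : ι → V} {k l : ℕ} (hc : CoversWith F h k) (hkl : k ≤ l) :
    CoversWith F h l := fun v => by
  obtain ⟨s, hs, hv⟩ := hc v
  exact ⟨s, hs.trans hkl, hv⟩

theorem CoversWith.reindex {h : ι → V} {k : ℕ} (hc : CoversWith F h k) (e : κ ≃ ι) :
    CoversWith F (h ∘ e) k := fun v => by
  obtain ⟨s, hs, hv⟩ := hc v
  refine ⟨s.map e.symm.toEmbedding, by simpa using hs, ?_⟩
  convert hv using 2
  ext x
  simp only [Finset.coe_map, Set.mem_image, Function.comp_apply]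
  constructor
  · rintro ⟨_, ⟨i, hi, rfl⟩, rfl⟩
    exact ⟨i, hi, by simp⟩
  · rintro ⟨i, hi, rfl⟩
    exact ⟨e.symm i, ⟨i, hi, rfl⟩, by simp⟩

theorem CoversWith.map {h : ι → V} {k : ℕ} (hc : CoversWith F h k) (e : V ≃ₗ[F] W) :
    CoversWith F (e ∘ h) k := fun w => by
  obtain ⟨s, hs, hv⟩ := hc (e.symm w)
  refine ⟨s, hs, ?_⟩
  have := Submodule.mem_map_of_mem (f := e.toLinearMap) hv
  rw [Submodule.map_span, ← Set.image_comp] at this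
  simpa using this

theorem not_coversWith_zero [Nontrivial V] (h : ι → V) : ¬ CoversWith F h 0 := fun hc => by
  obtain ⟨v, hv⟩ := exists_ne (0 : V)
  obtain ⟨s, hs, hv'⟩ := hc v
  obtain rfl : s = ∅ := by simpa using hs
  simp at hv'
  exact hv hv'

/-- The family of all vectors covers with one vector at a time. -/
theorem coversWith_id : CoversWith F (id : V → V) 1 := fun v =>
  ⟨{v}, by simp, by simp⟩

theorem CoversWith.span_eq_top {h : ι → V} {k : ℕ} (hc : CoversWith F h k) :
    Submodule.span F (Set.range h) = ⊤ := by
  refine Submodule.eq_top_iff'.2 fun v => ?_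
  obtain ⟨s, -, hv⟩ := hc v
  exact Submodule.span_mono (Set.image_subset_range _ _) hv

open Classical in
/-- Adding a multiple of one member of a family to another raises the covering radius by at most
one. -/
theorem CoversWith.update_add_smul {h : ι → V} {i j : ι} (hij : j ≠ i) {g : V} {k : ℕ}
    (hc : CoversWith F (Function.update h i g) k) (c : F) :
    CoversWith F (Function.update h i (g + c • h j)) (k + 1) := fun v => by
  obtain ⟨s, hs, hv⟩ := hc v
  refine ⟨insert j s, (Finset.card_insert_le _ _).trans (by omega), ?_⟩
  refine Submodule.span_le.2 ?_ hv
  rintro _ ⟨l, hl, rfl⟩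
  set S := Submodule.span F
    (Function.update h i (g + c • h j) '' ((insert j s : Finset ι) : Set ι)) with hS
  have hmem : ∀ m ∈ insert j s, Function.update h i (g + c • h j) m ∈ S := fun m hm =>
    Submodule.subset_span ⟨m, hm, rfl⟩
  by_cases hli : l = i
  · subst hli
    have h1 := hmem l (Finset.mem_insert_of_mem hl)
    have h2 := hmem j (Finset.mem_insert_self _ _)
    rw [Function.update_self] at h1
    rw [Function.update_of_ne hij] at h2
    simpa using S.sub_mem h1 (S.smul_mem c h2)
  · have h1 := hmem l (Finset.mem_insert_of_mem hl)
    rw [Function.update_of_ne hli] at h1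
    simpa [Function.update_of_ne hli] using h1

open Classical in
/-- If no family obtained from `h` by changing its `i`-th member has covering radius exactly `k`,
then a member in the span of the others may be replaced by zero: on the way from `h i` to `0` along
multiples of the other members, the covering radius moves in steps of size at most one and never
meets `k`, so it stays below `k`. -/
theorem CoversWith.update_zero_of_not_isLeast {h : ι → V} {i : ι} {k : ℕ} (hc : CoversWith F h k)
    (hi : h i ∈ Submodule.span F (h '' {i}ᶜ))
    (hex : ∀ g, ¬ IsLeast {l | CoversWith F (Function.update h i g) l} k) :
    CoversWith F (Function.update h i 0) k := by
  have step : ∀ g (j : ι) (c : F), j ≠ i → CoversWith F (Function.update h i g) k →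
      CoversWith F (Function.update h i (g + c • h j)) k := by
    intro g j c hji hg
    have hnot := hex g
    have : ∃ l, l < k ∧ CoversWith F (Function.update h i g) l := by
      by_contra! hcon
      exact hnot ⟨hg, fun l hl => not_lt.1 fun hlt => hcon l hlt hl⟩
    obtain ⟨l, hlk, hl⟩ := this
    exact (hl.update_add_smul hji c).mono hlk
  have key : ∀ x ∈ Submodule.span F (h '' {i}ᶜ), ∀ g,
      CoversWith F (Function.update h i g) k → CoversWith F (Function.update h i (g + x)) k := by
    intro x hx
    induction hx using Submodule.closure_induction with
    | zero => intro g hg; simpa using hg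
    | add x y _ _ hx hy => intro g hg; rw [← add_assoc]; exact hy _ (hx _ hg)
    | smul_mem c x hx =>
      obtain ⟨j, hj, rfl⟩ := hx
      intro g hg
      exact step g j c hj hg
  simpa using key _ (Submodule.neg_mem _ hi) (h i) (by simpa using hc)

/-- Every covering radius up to the dimension is attained: a family that covers with `k` vectors
can be changed, without changing its size, into a family with covering radius exactly `k`. -/
theorem CoversWith.exists_isLeast [Fintype ι] [FiniteDimensional F V] {h : ι → V} {k : ℕ}
    (hc : CoversWith F h k) (hk : k ≤ Module.finrank F V) :
    ∃ h' : ι → V, IsLeast {l | CoversWith F h' l} k := by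
  classical
  by_contra! hex
  -- Among the families covering with `k` vectors, take one with the fewest nonzero members.
  have hne : ∃ n, ∃ h : ι → V, CoversWith F h k ∧ (Finset.univ.filter fun i => h i ≠ 0).card = n :=
    ⟨_, h, hc, rfl⟩
  obtain ⟨h, hc, hcard⟩ := Nat.find_spec hne
  obtain ⟨l, hlk, hl⟩ : ∃ l, l < k ∧ CoversWith F h l := by
    by_contra! hcon
    exact hex h ⟨hc, fun l hl => not_lt.1 fun hlt => hcon l hlt hl⟩
  obtain ⟨s, hs, hv⟩ := hl (∑ i, h i)
  have hsub : (Finset.univ.filter fun i => h i ≠ 0) ⊆ s := by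
    intro i hi
    by_contra his
    have hi0 : h i ≠ 0 := by simpa using hi
    have hspan : h i ∈ Submodule.span F (h '' {i}ᶜ) := by
      have h1 : (∑ i, h i) ∈ Submodule.span F (h '' {i}ᶜ) := by
        refine Submodule.span_mono (Set.image_mono ?_) hv
        rintro j hj rfl
        exact his hj
      have h2 : (∑ j ∈ Finset.univ.erase i, h j) ∈ Submodule.span F (h '' {i}ᶜ) :=
        Submodule.sum_mem _ fun j hj =>
          Submodule.subset_span ⟨j, by simpa using hj, rfl⟩
      rw [← Finset.add_sum_erase _ _ (Finset.mem_univ i)] at h1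
      simpa using Submodule.sub_mem _ h1 h2
    have h0 := hc.update_zero_of_not_isLeast hspan fun g => hex _
    refine Nat.find_min hne ?_ ⟨_, h0, rfl⟩
    rw [← hcard]
    refine Finset.card_lt_card ⟨fun j hj => ?_, fun hcon => ?_⟩
    · by_cases hji : j = i
      · subst hji; exact hi
      · simpa [Function.update_of_ne hji] using hj
    · simpa using hcon hi
  have htop : Submodule.span F
      (h '' ((Finset.univ.filter fun i => h i ≠ 0 : Finset ι) : Set ι)) = ⊤ := by
    rw [← hc.span_eq_top]
    refine le_antisymm (Submodule.span_mono (Set.image_subset_range _ _)) (Submodule.span_le.2 ?_)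
    rintro _ ⟨i, rfl⟩
    by_cases hi : h i = 0
    · rw [hi]; exact Submodule.zero_mem _
    · exact Submodule.subset_span ⟨i, by simpa using hi, rfl⟩
  have h3 : Module.finrank F V ≤ s.card := by
    rw [← finrank_top F V, ← htop]
    have h4 := finrank_span_finset_le_card (R := F) ((Finset.univ.filter fun i => h i ≠ 0).image h)
    rw [Finset.coe_image] at h4
    exact h4.trans (Finset.card_image_le.trans (Finset.card_le_card hsub))
  omega

end Covers

/-! ### Codes and saturating sets as covering families -/

section Codes

variable {F : Type u} [Field F]

open Classical in
/-- The kernel of the matrix with columns `h` has covering radius `k` exactly when `h` does. -/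
theorem hasCoveringRadius_ker_iff {n : ℕ} {V : Type*} [AddCommGroup V] [Module F V]
    (f : (Fin n → F) →ₗ[F] V) (hf : Function.Surjective f) (R : ℕ) :
    HasCoveringRadius (LinearMap.ker f) R ↔
      IsLeast {k | CoversWith F (fun i => f (Pi.single i 1)) k} R := by
  have hfx : ∀ x : Fin n → F, f x = ∑ i, x i • f (Pi.single i 1) := fun x => by
    conv_lhs => rw [pi_eq_sum_univ' x]
    simp only [map_sum, map_smul]
  suffices hset : {k : ℕ | ∀ v : Fin n → F, ∃ c ∈ LinearMap.ker f, hammingDist v c ≤ k} =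
      {k | CoversWith F (fun i => f (Pi.single i 1)) k} by
    rw [HasCoveringRadius, hset]
  ext k
  simp only [Set.mem_ofPred_eq]
  constructor
  · intro H v
    obtain ⟨x, rfl⟩ := hf v
    obtain ⟨c, hc, hd⟩ := H x
    refine ⟨Finset.univ.filter fun i => x i ≠ c i, hd, ?_⟩
    have : f x = f (x - c) := by rw [map_sub, LinearMap.mem_ker.1 hc, sub_zero]
    rw [this, hfx]
    refine Submodule.sum_mem _ fun i _ => ?_
    by_cases hi : x i = c i
    · simp [hi]
    · exact Submodule.smul_mem _ _ (Submodule.subset_span ⟨i, by simpa using hi, rfl⟩)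
  · intro H x
    obtain ⟨s, hs, hv⟩ := H (f x)
    obtain ⟨a, ha⟩ := Submodule.mem_span_image_finset_iff_exists_fun' F |>.1 hv
    refine ⟨x - fun i => if i ∈ s then a i else 0, ?_, ?_⟩
    · rw [LinearMap.mem_ker, map_sub, sub_eq_zero, ← ha, hfx (fun i => if i ∈ s then a i else 0)]
      simp
    · refine (Finset.card_le_card fun i hi => ?_).trans hs
      by_contra his
      simp [his] at hi

theorem mem_codeLengths_iff {n r R : ℕ} :
    n ∈ codeLengths F r R ↔ ∃ h : Fin n → Fin r → F, IsLeast {k | CoversWith F h k} R := by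
  constructor
  · rintro ⟨C, hC, hR⟩
    have hq : Module.finrank F ((Fin n → F) ⧸ C) = Module.finrank F (Fin r → F) := by
      have := C.finrank_quotient_add_finrank
      simp only [Module.finrank_fin_fun] at this ⊢
      omega
    let e := LinearEquiv.ofFinrankEq _ _ hq
    let f : (Fin n → F) →ₗ[F] (Fin r → F) := e.toLinearMap ∘ₗ C.mkQ
    have hker : LinearMap.ker f = C := by
      rw [LinearMap.ker_comp_of_ker_eq_bot _ e.ker, Submodule.ker_mkQ]
    refine ⟨fun i => f (Pi.single i 1), ?_⟩
    rw [← hasCoveringRadius_ker_iff f (e.surjective.comp C.mkQ_surjective), hker]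
    exact hR
  · rintro ⟨h, hR⟩
    let f : (Fin n → F) →ₗ[F] (Fin r → F) := Fintype.linearCombination F h
    have hf : Function.Surjective f := by
      rw [← LinearMap.range_eq_top, Fintype.range_linearCombination]
      exact CoversWith.span_eq_top hR.1
    refine ⟨LinearMap.ker f, ?_, ?_⟩
    · have := f.finrank_range_add_finrank_ker
      rw [LinearMap.range_eq_top.2 hf, finrank_top] at this
      simp only [Module.finrank_fin_fun] at this
      omega
    · rw [hasCoveringRadius_ker_iff f hf]
      simpa [f, Fintype.linearCombination_apply_single] using hR

/-- Projective dimension versus vector space dimension: the `ρ + 1` in the definition of a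
saturating set turns into the covering radius `ρ + 1`, since no family covers with `0` vectors. -/
theorem isSaturating_iff {N ρ : ℕ} {S : Finset (PG F N)} {ι : Type*} {h : ι → Fin (N + 1) → F}
    (H : ∀ k, (∀ A : PG F N, IsCombinationOfAtMost S k A) ↔ CoversWith F h k) :
    IsSaturating S ρ ↔ IsLeast {k | CoversWith F h k} (ρ + 1) := by
  simp only [IsSaturating, IsLeast, lowerBounds, Set.mem_ofPred_eq, H]
  refine and_congr_right fun _ => ⟨fun h1 k hk => ?_, fun h1 k hk => by have := h1 hk; omega⟩
  cases k with
  | zero => exact absurd hk (not_coversWith_zero h)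
  | succ k => have := h1 hk; omega

theorem exists_isLeast_coversWith_of_mem_saturatingSizes {n N ρ : ℕ}
    (hn : n ∈ saturatingSizes F N ρ) :
    ∃ h : Fin n → Fin (N + 1) → F, IsLeast {k | CoversWith F h k} (ρ + 1) := by
  classical
  obtain ⟨S, rfl, hS⟩ := hn
  let e := S.equivFin
  let h : Fin S.card → Fin (N + 1) → F := fun i => (e.symm i).1.rep
  have hspan : ∀ s : Finset (Fin S.card),
      Submodule.span F (h '' s) = ⨆ P ∈ s.image fun i => (e.symm i).1, P.submodule := by
    intro s
    rw [Submodule.span_eq_iSup_of_singleton_spans, iSup_image, Finset.iSup_finset_image]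
    simp [h, Projectivization.submodule_eq]
  refine ⟨h, (isSaturating_iff fun k => ⟨fun H v => ?_, fun H A => ?_⟩).1 hS⟩
  · by_cases hv : v = 0
    · exact ⟨∅, by simp, by simp [hv]⟩
    obtain ⟨T, hTS, hT, hA⟩ := H (Projectivization.mk F v hv)
    refine ⟨Finset.univ.filter fun i => (e.symm i).1 ∈ T, ?_, ?_⟩
    · refine le_trans ?_ hT
      refine Finset.card_le_card_of_injOn (fun i => (e.symm i).1) (fun i hi => by simpa using hi) ?_
      exact fun i _ j _ hij => e.symm.injective (Subtype.ext hij)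
    · rw [hspan]
      have himg : ((Finset.univ.filter fun i => (e.symm i).1 ∈ T).image fun i => (e.symm i).1)
          = T := by
        ext P
        simp only [Finset.mem_image, Finset.mem_filter, Finset.mem_univ, true_and]
        constructor
        · rintro ⟨i, hi, rfl⟩; exact hi
        · exact fun hP => ⟨e ⟨P, hTS hP⟩, by simpa using hP, by simp⟩
      rw [himg]
      apply hA
      rw [Projectivization.submodule_mk]
      exact Submodule.mem_span_singleton_self v
  · obtain ⟨s, hs, hv⟩ := H A.rep
    refine ⟨s.image fun i => (e.symm i).1, ?_, Finset.card_image_le.trans hs, ?_⟩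
    · intro P hP
      obtain ⟨i, -, rfl⟩ := Finset.mem_image.1 hP
      exact (e.symm i).2
    · rw [← hspan, Projectivization.submodule_eq]
      simpa using hv

/-- The points represented by the nonzero members of a family form a saturating set. -/
theorem exists_mem_saturatingSizes_of_isLeast_coversWith {n N ρ : ℕ} {h : Fin n → Fin (N + 1) → F}
    (hh : IsLeast {k | CoversWith F h k} (ρ + 1)) : ∃ m ≤ n, m ∈ saturatingSizes F N ρ := by
  classical
  have hne : Nonempty (PG F N) :=
    ⟨Projectivization.mk F (fun _ => 1) fun h0 => one_ne_zero (congrFun h0 0)⟩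
  let pt : Fin n → PG F N := fun i =>
    if hi : h i = 0 then Classical.arbitrary _ else Projectivization.mk F (h i) hi
  have hpt : ∀ i, h i ≠ 0 → (pt i).submodule = Submodule.span F {h i} := fun i hi => by
    simp [pt, hi, Projectivization.submodule_mk]
  let I : Finset (Fin n) := Finset.univ.filter fun i => h i ≠ 0
  have hI : ∀ i, i ∈ I ↔ h i ≠ 0 := fun i => by simp [I]
  refine ⟨(I.image pt).card, Finset.card_image_le.trans ?_, I.image pt, rfl, ?_⟩
  · simpa using Finset.card_le_univ I
  refine (isSaturating_iff fun k => ⟨fun H v => ?_, fun H A => ?_⟩).2 hh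
  · by_cases hv : v = 0
    · exact ⟨∅, by simp, by simp [hv]⟩
    obtain ⟨T, hTS, hT, hA⟩ := H (Projectivization.mk F v hv)
    obtain ⟨s, hsI, hinj, rfl⟩ := 
      Finset.exists_subset_injOn_image_eq_of_surjOn (f := pt) I T fun P hP => by
        simpa using hTS hP
    refine ⟨s, by rwa [Finset.card_image_of_injOn hinj] at hT, ?_⟩
    have hle : (⨆ P ∈ s.image pt, P.submodule) ≤ Submodule.span F (h '' s) := by
      refine iSup₂_le fun P hP => ?_
      obtain ⟨i, hi, rfl⟩ := Finset.mem_image.1 hP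
      rw [hpt i ((hI i).1 (hsI hi)), Submodule.span_singleton_le_iff_mem]
      exact Submodule.subset_span ⟨i, hi, rfl⟩
    apply hle
    apply hA
    rw [Projectivization.submodule_mk]
    exact Submodule.mem_span_singleton_self v
  · obtain ⟨s, hs, hv⟩ := H A.rep
    refine ⟨(s ∩ I).image pt, Finset.image_subset_image Finset.inter_subset_right,
      Finset.card_image_le.trans ((Finset.card_le_card Finset.inter_subset_left).trans hs), ?_⟩
    rw [Projectivization.submodule_eq, Submodule.span_singleton_le_iff_mem]
    refine Submodule.span_le.2 ?_ hv
    rintro _ ⟨i, hi, rfl⟩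
    by_cases h0 : h i = 0
    · rw [h0]; exact Submodule.zero_mem _
    · have : (pt i).submodule ≤ ⨆ P ∈ (s ∩ I).image pt, P.submodule :=
        le_iSup₂_of_le (pt i)
          (Finset.mem_image_of_mem _ (Finset.mem_inter.2 ⟨hi, (hI i).2 h0⟩)) le_rfl
      apply this
      rw [hpt i h0]
      exact Submodule.mem_span_singleton_self _

/-- The size of a family that covers with `R` vectors is a length of a code with covering radius
exactly `R`. -/
theorem exists_mem_codeLengths_of_coversWith {ι V : Type*} [Fintype ι] [AddCommGroup V] [Module F V]
    {r R : ℕ} (hV : Module.finrank F V = r) [FiniteDimensional F V] (hRr : R ≤ r) {h : ι → V}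
    (hc : CoversWith F h R) : Fintype.card ι ∈ codeLengths F r R := by
  let e : V ≃ₗ[F] (Fin r → F) := LinearEquiv.ofFinrankEq _ _ (by simpa using hV)
  refine mem_codeLengths_iff.2 ?_
  exact ((hc.map e).reindex (Fintype.equivFin ι).symm).exists_isLeast (by simpa using hRr)

theorem lengthFunction_le_of_coversWith {ι V : Type*} [Fintype ι] [AddCommGroup V] [Module F V]
    {r R : ℕ} (hV : Module.finrank F V = r) [FiniteDimensional F V] (hRr : R ≤ r) {h : ι → V}
    (hc : CoversWith F h R) : lengthFunction F r R ≤ Fintype.card ι :=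
  Nat.sInf_le (exists_mem_codeLengths_of_coversWith hV hRr hc)

theorem codeLengths_nonempty [Fintype F] {r R : ℕ} (hR : 1 ≤ R) (hRr : R ≤ r) :
    (codeLengths F r R).Nonempty := by
  classical
  exact ⟨_, exists_mem_codeLengths_of_coversWith (Module.finrank_fin_fun F) hRr
    (coversWith_id.mono hR)⟩

theorem saturatingSizes_nonempty [Fintype F] {N ρ : ℕ} (h : ρ ≤ N) :
    (saturatingSizes F N ρ).Nonempty := by
  obtain ⟨n, hn⟩ := codeLengths_nonempty (F := F) (r := N + 1) (R := ρ + 1) (by omega) (by omega)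
  obtain ⟨g, hg⟩ := mem_codeLengths_iff.1 hn
  obtain ⟨m, -, hm⟩ := exists_mem_saturatingSizes_of_isLeast_coversWith hg
  exact ⟨m, hm⟩

theorem lengthFunction_eq_smallestSaturating [Fintype F] {N ρ : ℕ} (h : ρ ≤ N) :
    lengthFunction F (N + 1) (ρ + 1) = smallestSaturating F N ρ := by
  refine le_antisymm ?_ ?_
  · exact Nat.sInf_le (mem_codeLengths_iff.2 (exists_isLeast_coversWith_of_mem_saturatingSizes
      (Nat.sInf_mem (saturatingSizes_nonempty h))))
  · obtain ⟨g, hg⟩ := mem_codeLengths_iff.1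
      (Nat.sInf_mem (codeLengths_nonempty (F := F) (r := N + 1) (R := ρ + 1) (by omega) (by omega)))
    obtain ⟨m, hmn, hm⟩ := exists_mem_saturatingSizes_of_isLeast_coversWith hg
    exact (Nat.sInf_le hm).trans hmn

end Codes

/-! ### Lifting to higher codimension -/

section Lift

variable {F ι V W : Type*} [Field F] [AddCommGroup V] [Module F V] [AddCommGroup W] [Module F W]

open Polynomial in
/-- A Vandermonde system with pairwise distinct nodes and as many equations as unknowns is solvable
over any vector space; the inverse matrix consists of the coefficients of the Lagrange basis. -/
theorem exists_sum_pow_smul_eq (s : Finset ι) {β : ι → F} (hβ : Set.InjOn β s) (y : ℕ → W) :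
    ∃ f : ι → W, ∀ j < s.card, ∑ i ∈ s, β i ^ j • f i = y j := by
  classical
  refine ⟨fun i => ∑ l ∈ Finset.range s.card, (Lagrange.basis s β i).coeff l • y l,
    fun j hj => ?_⟩
  have hX : (X ^ j : F[X]) = ∑ i ∈ s, C (β i ^ j) * Lagrange.basis s β i := by
    have h1 := Lagrange.eq_interpolate (f := (X ^ j : F[X])) hβ
      (by rw [degree_X_pow]; exact_mod_cast hj)
    conv_lhs => rw [h1]
    simp [Lagrange.interpolate_apply]
  have hc : ∀ l, (∑ i ∈ s, β i ^ j * (Lagrange.basis s β i).coeff l) = if l = j then 1 else 0 := by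
    intro l
    rw [← coeff_X_pow, hX, finsetSum_coeff]
    exact Finset.sum_congr rfl fun i _ => (coeff_C_mul _).symm
  simp_rw [Finset.smul_sum, smul_smul]
  rw [Finset.sum_comm]
  simp_rw [← Finset.sum_smul, hc]
  simp [hj]

/-- The `q ^ m`-concatenating family, for `W = F ^ m`: the vectors
`(h i, f, β i • f, β i ^ 2 • f, …)` with `f` in `W`, together with all vectors of `W` placed in one
of the `R` blocks. -/
def concatFamily (R : ℕ) (h : ι → V) (β : ι → F) : (ι × W) ⊕ (Fin R × W) → V × (Fin R → W) :=
  Sum.elim (fun p => (h p.1, fun j => β p.1 ^ (j : ℕ) • p.2)) fun p => (0, Pi.single p.1 p.2)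

/-- If the first component of a target uses `k` vectors of `h`, then the Vandermonde system adjusts
the first `k` blocks, and each of the other `R - k` blocks is corrected by one more vector. -/
theorem coversWith_concatFamily {R : ℕ} {h : ι → V} (hc : CoversWith F h R) {β : ι → F}
    (hβ : Function.Injective β) : CoversWith F (concatFamily (W := W) R h β) R := by
  classical
  rintro ⟨u, y⟩
  obtain ⟨s₀, hs₀, hu⟩ := hc u
  obtain ⟨c, hcu⟩ := (Submodule.mem_span_image_finset_iff_exists_fun' F).1 hu
  obtain ⟨s, hs, hcs, hu⟩ : ∃ s : Finset ι, s.card ≤ R ∧ (∀ i ∈ s, c i ≠ 0) ∧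
      ∑ i ∈ s, c i • h i = u := by
    refine ⟨s₀.filter fun i => c i ≠ 0, (Finset.card_filter_le _ _).trans hs₀, by simp, ?_⟩
    rw [← hcu]
    refine Finset.sum_filter_of_ne fun i _ hi h0 => hi (by rw [h0, zero_smul])
  obtain ⟨f, hf⟩ := exists_sum_pow_smul_eq s (hβ.injOn) fun j => if hj : j < R then y ⟨j, hj⟩ else 0
  let g : Fin R → W := fun j => y j - ∑ i ∈ s, β i ^ (j : ℕ) • f i
  have hg : ∀ j : Fin R, (j : ℕ) < s.card → g j = 0 := fun j hj => by
    simp [g, hf j hj]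
  let t : Finset (Fin R) := Finset.univ.filter fun j => s.card ≤ (j : ℕ)
  have ht : t.card ≤ R - s.card := by
    have h1 : t.card ≤ (Finset.Ico s.card R).card :=
      Finset.card_le_card_of_injOn (fun j : Fin R => (j : ℕ))
        (fun j hj => by simpa [t] using hj) fun i _ j _ hij => Fin.ext hij
    simpa using h1
  let a : ι → (ι × W) ⊕ (Fin R × W) := fun i => Sum.inl (i, (c i)⁻¹ • f i)
  let b : Fin R → (ι × W) ⊕ (Fin R × W) := fun j => Sum.inr (j, g j)
  refine ⟨s.image a ∪ t.image b, ?_, ?_⟩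
  · have h1 : (s.image a).card ≤ s.card := Finset.card_image_le
    have h2 : (t.image b).card ≤ t.card := Finset.card_image_le
    have h3 := Finset.card_union_le (s.image a) (t.image b)
    omega
  · have hv : (u, y) = ∑ i ∈ s, c i • concatFamily R h β (a i) +
        ∑ j ∈ t, concatFamily R h β (b j) := by
      refine Prod.ext ?_ ?_
      · simp [concatFamily, a, b, Prod.fst_sum, hu]
      · have h4 : ∑ j ∈ t, (Pi.single j (g j) : Fin R → W) = g := by
          refine (Finset.sum_subset (Finset.subset_univ t) fun j _ hj => ?_).trans
            (Finset.univ_sum_single g)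
          rw [hg j (by simpa [t] using hj), Pi.single_zero]
        have h5 : ∀ i ∈ s, c i • (fun j : Fin R => β i ^ (j : ℕ) • (c i)⁻¹ • f i) =
            fun j : Fin R => β i ^ (j : ℕ) • f i := fun i hi => by
          ext j
          simp only [Pi.smul_apply]
          rw [smul_comm (β i ^ (j : ℕ)), smul_smul, mul_inv_cancel₀ (hcs i hi), one_smul]
        simp only [concatFamily, a, b, Sum.elim_inl, Sum.elim_inr, Prod.snd_add,
          Prod.snd_sum, Prod.smul_snd]
        rw [h4, Finset.sum_congr rfl h5]
        ext j
        simp [g, Finset.sum_apply]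
    rw [hv]
    refine Submodule.add_mem _ (Submodule.sum_mem _ fun i hi => Submodule.smul_mem _ _ ?_)
      (Submodule.sum_mem _ fun j hj => ?_)
    · exact Submodule.subset_span ⟨a i, Finset.mem_union_left _ (Finset.mem_image_of_mem a hi), rfl⟩
    · exact Submodule.subset_span
        ⟨b j, Finset.mem_union_right _ (Finset.mem_image_of_mem b hj), rfl⟩

end Lift

section LiftCodes

variable {F : Type u} [Field F] [Fintype F]

/-- Lifting from codimension `R + 1` to codimension `t R + 1`. -/
theorem lengthFunction_le_of_coversWith_lift {ι : Type*} [Fintype ι] {R t : ℕ} (ht : 1 ≤ t)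
    {h : ι → Fin (R + 1) → F} (hc : CoversWith F h R)
    (hι : 2 ≤ t → Fintype.card ι ≤ Fintype.card F) :
    lengthFunction F (t * R + 1) R ≤ (Fintype.card ι + R) * Fintype.card F ^ (t - 1) := by
  classical
  obtain rfl | ht2 := ht.eq_or_lt
  · have := lengthFunction_le_of_coversWith (r := 1 * R + 1) (by simp) (by omega) hc
    simp only [Nat.sub_self, pow_zero, mul_one]
    omega
  · obtain ⟨β⟩ := Function.Embedding.nonempty_of_card_le (hι ht2)
    have hdim : Module.finrank F ((Fin (R + 1) → F) × (Fin R → Fin (t - 1) → F)) = t * R + 1 := by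
      obtain ⟨m, rfl⟩ : ∃ m, t = m + 1 := ⟨t - 1, by omega⟩
      simp [Module.finrank_pi_fintype]
      ring
    have := lengthFunction_le_of_coversWith hdim (by nlinarith)
      (coversWith_concatFamily (W := Fin (t - 1) → F) hc β.injective)
    refine this.trans (le_of_eq ?_)
    simp
    ring

end LiftCodes

/-! ### Bonferroni inequality and greedy choice -/

section Counting

open Classical in
/-- Bonferroni inequality for sets of size at least `x` with pairwise intersections of size at most
`y`. -/
theorem card_biUnion_ge {τ X : Type*} (s : Finset τ) (A : τ → Finset X) {x y : ℝ}
    (hx : ∀ i ∈ s, x ≤ (A i).card)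
    (hy : ∀ i ∈ s, ∀ j ∈ s, i ≠ j → ((A i ∩ A j).card : ℝ) ≤ y) :
    s.card * x - s.card * (s.card - 1) / 2 * y ≤ ((s.biUnion A).card : ℝ) := by
  induction s using Finset.induction_on with
  | empty => simp
  | insert a s ha ih =>
    have h1 := ih (fun i hi => hx i (Finset.mem_insert_of_mem hi))
      (fun i hi j hj => hy i (Finset.mem_insert_of_mem hi) j (Finset.mem_insert_of_mem hj))
    have h2 := hx a (Finset.mem_insert_self _ _)
    have h3 : ((A a ∩ s.biUnion A).card : ℝ) ≤ s.card * y := by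
      rw [Finset.inter_biUnion]
      calc (((s.biUnion fun i => A a ∩ A i).card : ℕ) : ℝ)
          ≤ ((∑ i ∈ s, (A a ∩ A i).card : ℕ) : ℝ) := by exact_mod_cast Finset.card_biUnion_le
        _ = ∑ i ∈ s, ((A a ∩ A i).card : ℝ) := by push_cast; rfl
        _ ≤ ∑ _i ∈ s, y := Finset.sum_le_sum fun i hi =>
            hy a (Finset.mem_insert_self _ _) i (Finset.mem_insert_of_mem hi)
              (fun h => ha (h ▸ hi))
        _ = s.card * y := by simp
    have h4 : ((A a ∪ s.biUnion A).card : ℝ) + (A a ∩ s.biUnion A).card =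
        (A a).card + (s.biUnion A).card := by exact_mod_cast Finset.card_union_add_card_inter _ _
    rw [Finset.biUnion_insert, Finset.card_insert_of_notMem ha]
    push_cast
    nlinarith

open Classical in
/-- Greedy covering: if every target in `U` is hit by a proportion at least `p` of all `x`, then
some `N` choices leave at most `(1 - p) ^ N * |U|` targets unhit. -/
theorem exists_greedy {X T : Type*} [Fintype X] [Nonempty X] (rel : X → T → Prop) (U : Finset T)
    {p : ℝ} (hp : p ≤ 1)
    (hU : ∀ u ∈ U, p * Fintype.card X ≤ ((Finset.univ.filter fun x => rel x u).card : ℝ)) (N : ℕ) :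
    ∃ b : Fin N → X, ((U.filter fun u => ∀ i, ¬ rel (b i) u).card : ℝ) ≤ (1 - p) ^ N * U.card := by
  induction N with
  | zero => exact ⟨Fin.elim0, by simp⟩
  | succ N ih =>
    obtain ⟨b, hb⟩ := ih
    set U' := U.filter fun u => ∀ i, ¬ rel (b i) u with hU'
    obtain ⟨x, -, hx⟩ : ∃ x ∈ (Finset.univ : Finset X),
        p * U'.card ≤ ((U'.filter fun u => rel x u).card : ℝ) := by
      refine Finset.exists_le_of_sum_le Finset.univ_nonempty ?_
      have h1 := Finset.sum_card_bipartiteAbove_eq_sum_card_bipartiteBelow rel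
        (s := (Finset.univ : Finset X)) (t := U')
      have h2 : (∑ x : X, ((U'.filter fun u => rel x u).card : ℝ)) =
          ∑ u ∈ U', ((Finset.univ.filter fun x => rel x u).card : ℝ) := by exact_mod_cast h1
      rw [h2]
      calc ∑ _x : X, p * (U'.card : ℝ) = ∑ _u ∈ U', p * (Fintype.card X : ℝ) := by
            simp; ring
        _ ≤ _ := Finset.sum_le_sum fun u hu => hU u (Finset.filter_subset _ _ hu)
    refine ⟨Fin.cons x b, ?_⟩
    have h3 : (U.filter fun u => ∀ i, ¬ rel ((Fin.cons x b : Fin (N + 1) → X) i) u) =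
        U'.filter fun u => ¬ rel x u := by
      ext u
      simp only [hU', Finset.mem_filter, Fin.forall_fin_succ, Fin.cons_zero, Fin.cons_succ]
      tauto
    have h4 : ((U'.filter fun u => rel x u).card : ℝ) + (U'.filter fun u => ¬ rel x u).card =
        U'.card := by exact_mod_cast Finset.card_filter_add_card_filter_not _
    rw [h3]
    calc ((U'.filter fun u => ¬ rel x u).card : ℝ) ≤ (1 - p) * U'.card := by linarith
      _ ≤ (1 - p) * ((1 - p) ^ N * U.card) := mul_le_mul_of_nonneg_left hb (by linarith)
      _ = _ := by ring

end Counting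

/-! ### Random extensions of an arc -/

section Arc

variable {F V ι : Type*} [Field F] [AddCommGroup V] [Module F V]

theorem finrank_span_image_of_linearIndepOn {v : ι → V} {T : Finset ι}
    (hT : LinearIndepOn F v (T : Set ι)) :
    Module.finrank F (Submodule.span F (v '' T)) = T.card := by
  classical
  have h := finrank_span_finset_eq_card (R := F) (s := T.image v)
    (by rw [Finset.coe_image]; exact hT.id_image)
  rwa [Finset.coe_image, Finset.card_image_of_injOn hT.injOn] at h

theorem finrank_span_insert_image_of_linearIndepOn {v : ι → V} {T : Finset ι}
    (hT : LinearIndepOn F v (T : Set ι)) {B : V} (hB : B ∉ Submodule.span F (v '' T)) :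
    Module.finrank F (Submodule.span F (insert B (v '' T))) = T.card + 1 := by
  classical
  have h := finrank_span_finset_eq_card (R := F) (s := insert B (T.image v))
    (by rw [Finset.coe_insert, Finset.coe_image]; exact hT.id_image.id_insert hB)
  rw [Finset.coe_insert, Finset.coe_image, Finset.card_insert_of_notMem,
    Finset.card_image_of_injOn hT.injOn] at h
  · exact h
  · intro hmem
    exact hB (Submodule.subset_span (by simpa using hmem))

open Classical in
/-- Let any `k + 1` members of `v` be independent, and let `B` be outside the span of any `k + 1`
of them. Then `B` lies in the span of a vector `a` and some `k` members of `v` for many `a`: the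
subspaces spanned by `B` and `k` members of `v` are pairwise distinct, because a coincidence would
put `B` in the span of `k + 1` members, and any `a` in such a subspace but not in the span of the
`k` members of `v` will do. -/
theorem card_extension_ge [Fintype F] [Fintype V] [Fintype ι] {v : ι → V} {k : ℕ}
    (hv : ∀ T : Finset ι, T.card ≤ k + 1 → LinearIndepOn F v (T : Set ι)) {B : V}
    (hB : ∀ T : Finset ι, T.card ≤ k + 1 → B ∉ Submodule.span F (v '' T)) {m : ℝ}
    (hm : m = (Fintype.card ι).choose k) {rel : V → Prop}
    (hrel : ∀ a, ∀ T : Finset ι, T.card = k → B ∈ Submodule.span F (insert a (v '' T)) → rel a) :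
    m * ((Fintype.card F : ℝ) ^ (k + 1) - (Fintype.card F : ℝ) ^ k)
        - m * (m - 1) / 2 * (Fintype.card F : ℝ) ^ k ≤
      ((Finset.univ.filter fun a : V => rel a).card : ℝ) := by
  have hcard : ∀ S : Submodule F V,
      (Finset.univ.filter fun a => a ∈ S).card = Fintype.card F ^ Module.finrank F S :=
    fun S => by rw [← Module.card_eq_pow_finrank, Fintype.card_subtype]
  let H : Finset ι → Submodule F V := fun T => Submodule.span F (insert B (v '' T))
  let G : Finset ι → Submodule F V := fun T => Submodule.span F (v '' T)
  have hG : ∀ T, T.card = k → Module.finrank F (G T) = k := fun T hT => by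
    rw [← hT]; exact finrank_span_image_of_linearIndepOn (hv T (by omega))
  have hH : ∀ T, T.card = k → Module.finrank F (H T) = k + 1 := fun T hT => by
    have := finrank_span_insert_image_of_linearIndepOn (hv T (by omega)) (hB T (by omega))
    rw [hT] at this
    exact this
  have hGH : ∀ T, G T ≤ H T := fun T => Submodule.span_mono (Set.subset_insert _ _)
  have hne : ∀ T, T.card = k → ∀ T', T'.card = k → T ≠ T' → H T ≠ H T' := by
    intro T hT T' hT' hTT' heq
    obtain ⟨i, hi', hi⟩ : ∃ i ∈ T', i ∉ T := by
      by_contra! hcon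
      exact hTT' (Finset.eq_of_subset_of_card_le hcon (by omega)).symm
    have hiH : v i ∈ H T := by
      rw [heq]; exact Submodule.subset_span (Set.mem_insert_of_mem _ ⟨i, hi', rfl⟩)
    have hindep := hv (insert i T) (by rw [Finset.card_insert_of_notMem hi]; omega)
    rw [Finset.coe_insert, linearIndepOn_insert (by simpa using hi)] at hindep
    have := mem_span_insert_exchange hiH hindep.2
    refine hB (insert i T) (by rw [Finset.card_insert_of_notMem hi]; omega) ?_
    rwa [Finset.coe_insert, Set.image_insert_eq]
  let A : Finset ι → Finset V := fun T => Finset.univ.filter fun a => a ∈ H T ∧ a ∉ G T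
  have hA : ∀ T, T.card = k → (Fintype.card F : ℝ) ^ (k + 1) - (Fintype.card F : ℝ) ^ k ≤
      (A T).card := by
    intro T hT
    have h1 : (Finset.univ.filter fun a => a ∈ H T).card = Fintype.card F ^ (k + 1) := by
      rw [hcard, hH T hT]
    have h2 : (Finset.univ.filter fun a => a ∈ G T).card = Fintype.card F ^ k := by
      rw [hcard, hG T hT]
    have h3 : (Finset.univ.filter fun a => a ∈ H T) ⊆
        A T ∪ (Finset.univ.filter fun a => a ∈ G T) := by
      intro a ha
      simp only [A, Finset.mem_union, Finset.mem_filter, Finset.mem_univ, true_and] at ha ⊢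
      by_cases haG : a ∈ G T
      · exact Or.inr haG
      · exact Or.inl ⟨ha, haG⟩
    have h4 := (Finset.card_le_card h3).trans (Finset.card_union_le _ _)
    rw [h1, h2] at h4
    have h5 : (Fintype.card F : ℝ) ^ (k + 1) ≤ (A T).card + (Fintype.card F : ℝ) ^ k := by
      exact_mod_cast h4
    linarith
  have hAA : ∀ T, T.card = k → ∀ T', T'.card = k → T ≠ T' →
      ((A T ∩ A T').card : ℝ) ≤ (Fintype.card F : ℝ) ^ k := by
    intro T hT T' hT' hTT'
    have hlt : H T ⊓ H T' < H T := by
      refine lt_of_le_of_ne inf_le_left fun h => hne T hT T' hT' hTT' ?_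
      exact Submodule.eq_of_le_of_finrank_eq (inf_eq_left.1 h) (by rw [hH T hT, hH T' hT'])
    have h1 := Submodule.finrank_lt_finrank_of_lt hlt
    rw [hH T hT] at h1
    have h2 : (A T ∩ A T').card ≤ Fintype.card F ^ Module.finrank F ↥(H T ⊓ H T') := by
      rw [← hcard]
      refine Finset.card_le_card fun a ha => ?_
      simp only [A, Finset.mem_inter, Finset.mem_filter, Finset.mem_univ, true_and] at ha
      simp only [Finset.mem_filter, Finset.mem_univ, true_and, Submodule.mem_inf]
      exact ⟨ha.1.1, ha.2.1⟩
    have h3 := h2.trans (Nat.pow_le_pow_right Fintype.card_pos (by omega : _ ≤ k))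
    exact_mod_cast h3
  have hP : ∀ T, T ∈ (Finset.univ : Finset ι).powersetCard k ↔ T.card = k := fun T => by
    simp [Finset.mem_powersetCard]
  have h := card_biUnion_ge ((Finset.univ : Finset ι).powersetCard k) A
    (fun T hT => hA T ((hP T).1 hT))
    fun T hT T' hT' hTT' => hAA T ((hP T).1 hT) T' ((hP T').1 hT') hTT'
  rw [Finset.card_powersetCard, Finset.card_univ, ← hm] at h
  refine h.trans ?_
  norm_cast
  refine Finset.card_le_card fun a ha => ?_
  obtain ⟨T, hT, haT⟩ := Finset.mem_biUnion.1 ha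
  simp only [A, Finset.mem_filter, Finset.mem_univ, true_and] at haT ⊢
  exact hrel a T ((hP T).1 hT) (mem_span_insert_exchange haT.1 haT.2)

/-- An arc can be completed to a covering family by `N` vectors, as soon as the expected number of
vectors left uncovered by `N` random choices is below one. -/
theorem exists_coversWith_of_arc [Fintype F] [Fintype V] [Fintype ι] {v : ι → V} {k N : ℕ}
    (hv : ∀ T : Finset ι, T.card ≤ k + 1 → LinearIndepOn F v (T : Set ι)) {m p : ℝ}
    (hm : m = (Fintype.card ι).choose k) (hp1 : p ≤ 1)
    (hp : p * Fintype.card V ≤ m * ((Fintype.card F : ℝ) ^ (k + 1) - (Fintype.card F : ℝ) ^ k)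
        - m * (m - 1) / 2 * (Fintype.card F : ℝ) ^ k)
    (hN : (1 - p) ^ N * Fintype.card V < 1) :
    ∃ h : ι ⊕ Fin N → V, CoversWith F h (k + 1) := by
  classical
  let U : Finset V := Finset.univ.filter fun B =>
    ∀ T : Finset ι, T.card ≤ k + 1 → B ∉ Submodule.span F (v '' T)
  obtain ⟨rel, hrel⟩ : ∃ rel : V → V → Prop, ∀ a B, rel a B ↔
      ∃ T : Finset ι, T.card = k ∧ B ∈ Submodule.span F (insert a (v '' T)) :=
    ⟨_, fun _ _ => Iff.rfl⟩
  obtain ⟨b, hb⟩ := exists_greedy rel U hp1 (fun B hB => hp.trans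
    (card_extension_ge hv (Finset.mem_filter.1 hB).2 hm fun a T hT h =>
      (hrel a B).2 ⟨T, hT, h⟩)) N
  have hUV : (1 - p) ^ N * (U.card : ℝ) ≤ (1 - p) ^ N * Fintype.card V := by
    refine mul_le_mul_of_nonneg_left ?_ (pow_nonneg (by linarith) _)
    exact_mod_cast Finset.card_le_univ U
  have hempty := hb.trans_lt (hUV.trans_lt hN)
  rw [Nat.cast_lt_one, Finset.card_eq_zero, Finset.filter_eq_empty_iff] at hempty
  refine ⟨Sum.elim v b, fun B => ?_⟩
  by_cases hBU : B ∈ U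
  · have h1 := hempty hBU
    push Not at h1
    obtain ⟨i, hi⟩ := h1
    obtain ⟨T, hT, hBT⟩ := (hrel _ _).1 hi
    refine ⟨insert (Sum.inr i) (T.map Function.Embedding.inl), ?_, ?_⟩
    · exact (Finset.card_insert_le _ _).trans (by simp [hT])
    · have himg : Sum.elim v b '' ((insert (Sum.inr i) (T.map Function.Embedding.inl) :
          Finset (ι ⊕ Fin N)) : Set (ι ⊕ Fin N)) = insert (b i) (v '' T) := by
        simp [Set.image_insert_eq, Set.image_image]
      rwa [himg]
  · simp only [U, Finset.mem_filter, Finset.mem_univ, true_and] at hBU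
    push Not at hBU
    obtain ⟨T, hT, hBT⟩ := hBU
    refine ⟨T.map Function.Embedding.inl, by simpa using hT, ?_⟩
    have himg : Sum.elim v b '' ((T.map Function.Embedding.inl : Finset (ι ⊕ Fin N)) :
        Set (ι ⊕ Fin N)) = v '' T := by
      simp [Set.image_image]
    rwa [himg]

end Arc

section RationalNormalCurve

variable {F : Type u} [Field F]

open Polynomial in
/-- Any `n` points of the rational normal curve `x ↦ (1, x, …, x ^ (n - 1))` are independent. -/
theorem linearIndepOn_pow {ι : Type*} {n : ℕ} {a : ι → F} (ha : Function.Injective a)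
    (T : Finset ι) (hT : T.card ≤ n) :
    LinearIndepOn F (fun i => fun j : Fin n => a i ^ (j : ℕ)) (T : Set ι) := by
  classical
  rw [linearIndepOn_finset_iff]
  intro c hc i hi
  have hpow : ∀ j < n, ∑ l ∈ T, c l * a l ^ j = 0 := fun j hj => by
    simpa using congrFun hc ⟨j, hj⟩
  have heval : ∀ p : F[X], p.natDegree < n → ∑ l ∈ T, c l * p.eval (a l) = 0 := by
    intro p hp
    simp_rw [eval_eq_sum_range' hp, Finset.mul_sum]
    rw [Finset.sum_comm]
    refine Finset.sum_eq_zero fun j hj => ?_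
    have := hpow j (Finset.mem_range.1 hj)
    calc ∑ l ∈ T, c l * (p.coeff j * a l ^ j) = p.coeff j * ∑ l ∈ T, c l * a l ^ j := by
          rw [Finset.mul_sum]; exact Finset.sum_congr rfl fun l _ => by ring
      _ = 0 := by rw [this, mul_zero]
  have hpos : 0 < T.card := Finset.card_pos.2 ⟨i, hi⟩
  have h := heval (Lagrange.basis T a i)
    (by rw [Lagrange.natDegree_basis ha.injOn hi]; omega)
  rw [Finset.sum_eq_single_of_mem i hi, Lagrange.eval_basis_self ha.injOn hi, mul_one] at h
  · exact h
  · intro l hl hli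
    rw [Lagrange.eval_basis_of_ne hli.symm hl, mul_zero]

/-- All points of a line together with a basis of a complement: `q + k` vectors. -/
theorem exists_coversWith_line [Fintype F] (k : ℕ) :
    ∃ h : F ⊕ Fin (k + 1) → Fin (k + 2) → F, CoversWith F h (k + 1) := by
  classical
  -- the points `(x, 1, 0, …)` of the line, and the basis vectors other than the second one
  refine ⟨Sum.elim (fun x => Pi.single 0 x + Pi.single 1 1)
    fun i => Pi.single (Fin.succAbove 1 i) 1, fun v => ?_⟩
  have hv : v = ∑ i, v i • (Pi.single i 1 : Fin (k + 2) → F) := pi_eq_sum_univ' v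
  rw [Fin.sum_univ_succAbove _ 1] at hv
  by_cases h1 : v 1 = 0
  · refine ⟨Finset.univ.map Function.Embedding.inr, by simp, ?_⟩
    rw [h1, zero_smul, zero_add] at hv
    rw [hv]
    exact Submodule.sum_mem _ fun i _ => Submodule.smul_mem _ _
      (Submodule.subset_span ⟨Sum.inr i, by simp, rfl⟩)
  · obtain ⟨x, hx⟩ : ∃ x, x = v 0 / v 1 := ⟨_, rfl⟩
    refine ⟨insert (Sum.inl x) ((Finset.univ.erase 0).map Function.Embedding.inr), ?_, ?_⟩
    · exact (Finset.card_insert_le _ _).trans (by simp)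
    · rw [← Finset.add_sum_erase _ _ (Finset.mem_univ (0 : Fin (k + 1))), ← add_assoc] at hv
      have h2 : v 1 • (Pi.single 1 1 : Fin (k + 2) → F) +
          v (Fin.succAbove 1 0) • Pi.single (Fin.succAbove 1 0) 1 =
          v 1 • (Pi.single 0 (v 0 / v 1) + Pi.single 1 1) := by
        have h3 : Fin.succAbove (1 : Fin (k + 2)) 0 = 0 := by simp [Fin.succAbove]
        rw [h3, smul_add, ← Pi.single_smul, ← Pi.single_smul, ← Pi.single_smul]
        simp only [smul_eq_mul, mul_one, mul_div_cancel₀ _ h1]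
        exact add_comm _ _
      rw [h2, ← hx] at hv
      rw [hv]
      refine Submodule.add_mem _ (Submodule.smul_mem _ _ ?_)
        (Submodule.sum_mem _ fun i hi => Submodule.smul_mem _ _ ?_)
      · exact Submodule.subset_span ⟨Sum.inl x, by simp, rfl⟩
      · exact Submodule.subset_span ⟨Sum.inr i, by simpa using hi, rfl⟩

end RationalNormalCurve

/-! ### The functions in the bounds -/

section Functions

open Filter Topology

variable {R : ℕ} {lam x q : ℝ}

theorem rootQLn_pos (hq : 1 < q) : 0 < rootQLn R q :=
  Real.rpow_pos_of_pos (mul_pos (by linarith) (Real.log_pos hq)) _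

theorem rootQLn_pow (hR : R ≠ 0) (hq : 1 < q) : rootQLn R q ^ R = q * Real.log q := by
  rw [rootQLn, one_div]
  exact Real.rpow_inv_natCast_pow (mul_nonneg (by linarith) (Real.log_pos hq).le) hR

theorem rootQLn_strictMonoOn (hR : R ≠ 0) : StrictMonoOn (rootQLn R) (Set.Ioi 1) := by
  intro x hx y hy hxy
  simp only [Set.mem_Ioi] at hx hy
  have hlog := Real.log_lt_log (by linarith) hxy
  have hlx := Real.log_pos hx
  refine Real.rpow_lt_rpow (mul_nonneg (by linarith) hlx.le) ?_ (by positivity)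
  exact mul_lt_mul hxy hlog.le hlx (by linarith)

theorem tendsto_rootQLn (hR : R ≠ 0) : Tendsto (rootQLn R) atTop atTop :=
  (tendsto_rpow_atTop (by positivity)).comp (tendsto_id.atTop_mul_atTop₀ Real.tendsto_log_atTop)

/-- The `R`-th root of `q ln q` is negligible compared to `q`. -/
theorem eventually_mul_rootQLn_add_le (hR : 3 ≤ R) (c d : ℝ) :
    ∀ᶠ q : ℝ in atTop, c * rootQLn R q + d ≤ q + 1 := by
  have hR0 : (0 : ℝ) < R := by exact_mod_cast (by omega : 0 < R)
  have h1 : ∀ᶠ q : ℝ in atTop, rootQLn R q ≤ q ^ (2 / 3 : ℝ) := by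
    filter_upwards [eventually_gt_atTop 1] with q hq
    have h2 : q * Real.log q ≤ q ^ (2 : ℝ) := by
      rw [Real.rpow_two, sq]
      have h0 := Real.log_le_sub_one_of_pos (by linarith : 0 < q)
      exact mul_le_mul_of_nonneg_left (by linarith) (by linarith)
    calc rootQLn R q ≤ (q ^ (2 : ℝ)) ^ (1 / (R : ℝ)) :=
          Real.rpow_le_rpow (mul_nonneg (by linarith) (Real.log_pos hq).le) h2 (by positivity)
      _ = q ^ (2 * (1 / (R : ℝ))) := (Real.rpow_mul (by linarith) _ _).symm
      _ ≤ q ^ (2 / 3 : ℝ) := by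
          refine Real.rpow_le_rpow_of_exponent_le hq.le ?_
          rw [mul_one_div]
          exact div_le_div_of_nonneg_left (by norm_num) (by norm_num) (by exact_mod_cast hR)
  have h3 : Tendsto (fun q : ℝ => q ^ (-(1 / 3) : ℝ)) atTop (𝓝 0) :=
    tendsto_rpow_neg_atTop (by norm_num)
  have h4 : ∀ᶠ q : ℝ in atTop, |c| * q ^ (-(1 / 3) : ℝ) < 1 / 2 :=
    (h3.const_mul |c|).eventually_lt_const (by rw [mul_zero]; norm_num)
  filter_upwards [h1, h4, eventually_ge_atTop (2 * d), eventually_gt_atTop 1] with q h1 h4 h5 hq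
  have h6 : q ^ (2 / 3 : ℝ) = q ^ (-(1 / 3) : ℝ) * q := by
    rw [← Real.rpow_add_one (by linarith)]; norm_num
  have h7 : c * rootQLn R q ≤ |c| * (q ^ (-(1 / 3) : ℝ) * q) :=
    (mul_le_mul_of_nonneg_right (le_abs_self c) (rootQLn_pos hq).le).trans
      (mul_le_mul_of_nonneg_left (h1.trans h6.le) (abs_nonneg c))
  nlinarith

theorem betaFn_lt (hR : 2 ≤ R) (hq : 1 < q) : betaFn lam R q < lam := by
  have hR' : (2 : ℝ) ≤ R := by exact_mod_cast hR
  have := div_pos (by linarith : (0 : ℝ) < R - 1) (rootQLn_pos (R := R) hq)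
  rw [betaFn]
  linarith

theorem betaFn_strictMonoOn (hR : 2 ≤ R) : StrictMonoOn (betaFn lam R) (Set.Ioi 1) := by
  intro x hx y hy hxy
  have hR' : (2 : ℝ) ≤ R := by exact_mod_cast hR
  have := div_lt_div_of_pos_left (by linarith : (0 : ℝ) < R - 1) (rootQLn_pos (R := R) hx)
    (rootQLn_strictMonoOn (by omega) hx hy hxy)
  simp only [betaFn]
  linarith

theorem tendsto_betaFn (hR : R ≠ 0) : Tendsto (betaFn lam R) atTop (𝓝 lam) := by
  have := ((tendsto_rootQLn hR).const_div_atTop ((R : ℝ) - 1)).const_sub lam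
  rwa [sub_zero] at this

theorem upsilonFn_pos (hlam : 0 < lam) (hq : 1 < q) : 0 < upsilonFn lam R q := by
  have := Real.log_pos hq
  have : 0 < q := by linarith
  rw [upsilonFn]
  positivity

/-- `q Υ(q)` is the number `(λ L) ^ (R - 1) / (R - 1)!` that bounds the number of
`(R - 1)`-subsets of a set of size `λ L`, where `L ^ R = q ln q`. -/
theorem upsilonFn_mul (hR : 1 ≤ R) (hq : 1 < q) :
    upsilonFn lam R q * q = (lam * rootQLn R q) ^ (R - 1) / ((R - 1).factorial : ℝ) := by
  have hlog := Real.log_pos hq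
  have hq0 : 0 < q := by linarith
  have h1 : (Real.log q ^ (R - 1) / q) ^ (1 / (R : ℝ)) * q = rootQLn R q ^ (R - 1) := by
    have hL := (rootQLn_pos (R := R) hq).le
    refine (pow_left_inj₀ (by positivity) (pow_nonneg hL _) (by omega : R ≠ 0)).1 ?_
    rw [mul_pow, one_div, Real.rpow_inv_natCast_pow (by positivity) (by omega), ← pow_mul,
      mul_comm (R - 1), pow_mul, rootQLn_pow (by omega) hq, mul_pow]
    obtain ⟨k, rfl⟩ : ∃ k, R = k + 1 := ⟨R - 1, by omega⟩
    simp only [Nat.add_sub_cancel]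
    field_simp
    ring
  rw [upsilonFn, mul_assoc, h1, mul_pow]
  ring

theorem upsilonFn_antitoneOn (hR : 2 ≤ R) (hlam : 0 < lam) :
    AntitoneOn (upsilonFn lam R) (Set.Ici (Real.exp ((R : ℝ) - 1))) := by
  intro x hx y hy hxy
  have hR' : (2 : ℝ) ≤ R := by exact_mod_cast hR
  simp only [Set.mem_Ici] at hx hy
  have h1 : 1 < Real.exp ((R : ℝ) - 1) := Real.one_lt_exp_iff.2 (by linarith)
  have hlx := Real.log_pos (h1.trans_le hx)
  have hly := Real.log_pos (h1.trans_le hy)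
  have hcast : ((R - 1 : ℕ) : ℝ) = (R : ℝ) - 1 := by push_cast [show 1 ≤ R by omega]; ring
  have key : ∀ z : ℝ, 0 < z →
      Real.log z ^ (R - 1) / z = (Real.log z / z ^ ((R : ℝ) - 1)⁻¹) ^ (R - 1) := fun z hz => by
    rw [div_pow, ← hcast, Real.rpow_inv_natCast_pow hz.le (by omega)]
  have h2 := Real.log_div_self_rpow_antitoneOn (a := ((R : ℝ) - 1)⁻¹)
    (inv_pos.2 (by linarith)) (by simpa using hx) (by simpa using hy) hxy
  simp only at h2
  refine mul_le_mul_of_nonneg_left (Real.rpow_le_rpow ?_ ?_ (by positivity)) (by positivity)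
  · have : 0 < y := by linarith
    positivity
  · rw [key x (by linarith), key y (by linarith)]
    have : 0 < y := by linarith
    exact pow_le_pow_left₀ (by positivity) h2 _

theorem tendsto_upsilonFn (hR : R ≠ 0) : Tendsto (upsilonFn lam R) atTop (𝓝 0) := by
  have h1 : Tendsto (fun x : ℝ => Real.log x ^ (R - 1) / x) atTop (𝓝 0) :=
    Real.isLittleO_pow_log_id_atTop.tendsto_div_nhds_zero
  have h2 := (h1.rpow_const (p := 1 / (R : ℝ)) (Or.inr (by positivity))).const_mul
    (lam ^ (R - 1) / ((R - 1).factorial : ℝ))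
  rwa [Real.zero_rpow (by positivity), mul_zero] at h2

theorem continuousOn_upsilonFn : ContinuousOn (upsilonFn lam R) (Set.Ioi 0) := by
  refine ContinuousOn.mul continuousOn_const (ContinuousOn.rpow_const ?_ fun x _ =>
    Or.inr (by positivity))
  exact ((Real.continuousOn_log.mono fun x hx => ne_of_gt hx).pow _).div continuousOn_id
    fun x hx => ne_of_gt hx

theorem preQ_spec (hR : 2 ≤ R) (hlam : 0 < lam) :
    Real.exp ((R : ℝ) - 1) ≤ preQ lam R ∧ ∀ x, preQ lam R < x → upsilonFn lam R x ≤ 1 := by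
  rw [preQ]
  split_ifs with h
  · exact ⟨le_rfl, fun x hx =>
      (upsilonFn_antitoneOn hR hlam (Set.mem_Ici.2 le_rfl) hx.le hx.le).trans h⟩
  · push Not at h
    set S := {y : ℝ | Real.exp ((R : ℝ) - 1) < y ∧ upsilonFn lam R y = 1} with hS
    have hne : S.Nonempty := by
      have hev := (tendsto_upsilonFn (lam := lam) (R := R) (by omega)).eventually_lt_const
        zero_lt_one
      obtain ⟨M, hM1, hM⟩ := (hev.and (eventually_gt_atTop (Real.exp ((R : ℝ) - 1)))).exists
      have hcont : ContinuousOn (upsilonFn lam R) (Set.Icc (Real.exp ((R : ℝ) - 1)) M) :=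
        continuousOn_upsilonFn.mono fun x hx => (Real.exp_pos _).trans_le hx.1
      obtain ⟨y, hy, hy1⟩ := intermediate_value_Ioo' hM.le hcont ⟨hM1, h⟩
      exact ⟨y, hy.1, hy1⟩
    refine ⟨le_csInf hne fun y hy => hy.1.le, fun x hx => ?_⟩
    obtain ⟨y, hy, hyx⟩ := exists_lt_of_csInf_lt hne hx
    rw [← hy.2]
    exact upsilonFn_antitoneOn hR hlam hy.1.le (hy.1.trans hyx).le hyx.le

theorem exp_le_Qlam (hR : 2 ≤ R) (hlam : 0 < lam) : Real.exp ((R : ℝ) - 1) ≤ Qlam lam R :=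
  (preQ_spec hR hlam).1.trans (Nat.le_ceil _)

theorem one_lt_Qlam (hR : 2 ≤ R) (hlam : 0 < lam) : (1 : ℝ) < Qlam lam R := by
  have hR' : (2 : ℝ) ≤ R := by exact_mod_cast hR
  exact (Real.one_lt_exp_iff.2 (by linarith)).trans_le (exp_le_Qlam hR hlam)

theorem upsilonFn_le_one (hR : 2 ≤ R) (hlam : 0 < lam) (hx : (Qlam lam R : ℝ) < x) :
    upsilonFn lam R x ≤ 1 :=
  (preQ_spec hR hlam).2 x ((Nat.le_ceil _).trans_lt hx)

theorem two_sub_pos (hq : 1 < q) (hU : upsilonFn lam R q ≤ 1) :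
    0 < 2 - 1 / q - upsilonFn lam R q := by
  have : 1 / q < 1 := by rw [div_lt_one (by linarith)]; exact hq
  linarith

theorem omegaFn_strictAntiOn (hR : 2 ≤ R) (hlam : 0 < lam) (hb : 0 < betaFn lam R (Qlam lam R)) :
    StrictAntiOn (omegaFn lam R) (Set.Ioi (Qlam lam R : ℝ)) := by
  intro x hx y hy hxy
  simp only [Set.mem_Ioi] at hx hy
  have hQ := one_lt_Qlam hR hlam
  have hbx := hb.trans (betaFn_strictMonoOn hR hQ (hQ.trans hx) hx)
  have hbxy := betaFn_strictMonoOn (lam := lam) hR (hQ.trans hx) (hQ.trans hy) hxy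
  have hUxy := upsilonFn_antitoneOn hR hlam ((exp_le_Qlam hR hlam).trans hx.le)
    ((exp_le_Qlam hR hlam).trans hy.le) hxy.le
  have hdx := two_sub_pos (hQ.trans hx) (upsilonFn_le_one hR hlam hx)
  have h1 : 1 / y ≤ 1 / x := one_div_le_one_div_of_le (by linarith) hxy.le
  have h2 : 2 / (2 - 1 / y - upsilonFn lam R y) ≤ 2 / (2 - 1 / x - upsilonFn lam R x) :=
    div_le_div_of_nonneg_left (by norm_num) hdx (by linarith)
  have h3 : (R : ℝ) * (R.factorial : ℝ) / betaFn lam R y ^ (R - 1) <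
      (R : ℝ) * (R.factorial : ℝ) / betaFn lam R x ^ (R - 1) :=
    div_lt_div_of_pos_left (by positivity) (by positivity)
      (pow_lt_pow_left₀ hbxy hbx.le (by omega))
  rw [omegaFn, omegaFn, add_lt_add_iff_left]
  exact mul_lt_mul h3 h2 (div_pos two_pos (by linarith)) (by positivity)

theorem omegaFn_lt_Clam (hR : 2 ≤ R) (hlam : 0 < lam) (hb : 0 < betaFn lam R (Qlam lam R))
    (hx : (Qlam lam R : ℝ) < x) : omegaFn lam R x < Clam lam R := by
  have hQ := one_lt_Qlam hR hlam
  have hbx := betaFn_strictMonoOn (lam := lam) hR hQ (hQ.trans hx) hx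
  have hdx := two_sub_pos (hQ.trans hx) (upsilonFn_le_one hR hlam hx)
  have h1 : 1 / x ≤ 1 / (Qlam lam R : ℝ) := one_div_le_one_div_of_le (by linarith) hx.le
  have h1' : 1 / (Qlam lam R : ℝ) < 1 := by rw [div_lt_one (by linarith)]; exact hQ
  have h2 : 2 / (2 - 1 / x - upsilonFn lam R x) ≤
      2 * (Qlam lam R : ℝ) / ((Qlam lam R : ℝ) - 1) := by
    calc 2 / (2 - 1 / x - upsilonFn lam R x) ≤ 2 / (1 - 1 / (Qlam lam R : ℝ)) :=
          div_le_div_of_nonneg_left (by norm_num) (by linarith)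
            (by linarith [upsilonFn_le_one hR hlam hx])
      _ = _ := by
          have : (Qlam lam R : ℝ) - 1 ≠ 0 := by linarith
          have : (Qlam lam R : ℝ) ≠ 0 := by linarith
          field_simp
  have h3 : (R : ℝ) * (R.factorial : ℝ) / betaFn lam R x ^ (R - 1) <
      (R : ℝ) * (R.factorial : ℝ) / betaFn lam R (Qlam lam R) ^ (R - 1) :=
    div_lt_div_of_pos_left (by positivity) (by positivity)
      (pow_lt_pow_left₀ hbx hb.le (by omega))
  rw [omegaFn, Clam, add_lt_add_iff_left]
  exact mul_lt_mul h3 h2 (div_pos two_pos hdx) (by positivity)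

theorem Dlam_lt_omegaFn (hR : 2 ≤ R) (hlam : 0 < lam) (hq : 1 < q) (hb : 0 < betaFn lam R q)
    (hU : upsilonFn lam R q ≤ 1) : Dlam lam R < omegaFn lam R q := by
  have hdx := two_sub_pos hq hU
  have h3 : (R : ℝ) * (R.factorial : ℝ) / lam ^ (R - 1) <
      (R : ℝ) * (R.factorial : ℝ) / betaFn lam R q ^ (R - 1) :=
    div_lt_div_of_pos_left (by positivity) (by positivity)
      (pow_lt_pow_left₀ (betaFn_lt hR hq) hb.le (by omega))
  have h4 : 1 ≤ 2 / (2 - 1 / q - upsilonFn lam R q) := by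
    rw [one_le_div hdx]
    have := upsilonFn_pos (R := R) hlam hq
    have : 0 < 1 / q := one_div_pos.2 (by linarith)
    linarith
  rw [Dlam, omegaFn, add_lt_add_iff_left]
  exact h3.trans_le (le_mul_of_one_le_right (by positivity) h4)

/-- The minimum of `D_{λ,R}` over `λ` is attained where `λ ^ R = R (R - 1) R!`. -/
theorem Dmin_eq_Dlam (hR : 2 ≤ R) : ∃ lam : ℝ, 0 < lam ∧ Dmin R = Dlam lam R := by
  have hR' : (2 : ℝ) ≤ R := by exact_mod_cast hR
  have h1 : (0 : ℝ) < (R : ℝ) * ((R : ℝ) - 1) * (R.factorial : ℝ) :=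
    mul_pos (mul_pos (by linarith) (by linarith)) (by positivity)
  refine ⟨_, Real.rpow_pos_of_pos h1 (1 / (R : ℝ)), ?_⟩
  set l := ((R : ℝ) * ((R : ℝ) - 1) * (R.factorial : ℝ)) ^ (1 / (R : ℝ)) with hl
  have hl0 : 0 < l := Real.rpow_pos_of_pos h1 _
  have hpow : l ^ (R - 1) * l = (R : ℝ) * ((R : ℝ) - 1) * (R.factorial : ℝ) := by
    rw [← pow_succ, Nat.sub_add_cancel (by omega), hl, one_div,
      Real.rpow_inv_natCast_pow h1.le (by omega)]
  have h2 : (R : ℝ) * (R.factorial : ℝ) / l ^ (R - 1) = l / ((R : ℝ) - 1) := by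
    rw [div_eq_div_iff (by positivity) (by linarith)]
    linarith
  have h3 : (R : ℝ) - 1 ≠ 0 := by linarith
  rw [Dmin, Dlam, h2, ← hl]
  field_simp
  ring

theorem factorial_succ_le_pow (k : ℕ) : (k + 1).factorial ≤ (k + 1) ^ k := by
  induction k with
  | zero => simp
  | succ k ih =>
    rw [Nat.factorial_succ, pow_succ']
    exact Nat.mul_le_mul_left _ (ih.trans (Nat.pow_le_pow_left (by omega) k))

theorem Dlam_self_le (hR : 1 ≤ R) : Dlam R R ≤ 2 * R := by
  obtain ⟨k, rfl⟩ : ∃ k, R = k + 1 := ⟨R - 1, by omega⟩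
  have h1 : ((k + 1).factorial : ℝ) ≤ ((k + 1 : ℕ) : ℝ) ^ k := by
    exact_mod_cast factorial_succ_le_pow k
  have h2 : ((k + 1 : ℕ) : ℝ) * ((k + 1).factorial : ℝ) / ((k + 1 : ℕ) : ℝ) ^ k ≤
      ((k + 1 : ℕ) : ℝ) := by
    rw [div_le_iff₀ (by positivity)]
    exact mul_le_mul_of_nonneg_left h1 (by positivity)
  rw [Dlam, Nat.add_sub_cancel]
  linarith

/-! ### The two bounds -/

theorem mainTerm_eq {t : ℕ} (hR : R ≠ 0) (ht : 1 ≤ t) (hq : 1 < q) :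
    mainTerm R (t * R + 1) q = q ^ (t - 1) * rootQLn R q := by
  have hq0 : 0 < q := by linarith
  have hR' : (R : ℝ) ≠ 0 := by exact_mod_cast hR
  have h1 : (((t * R + 1 : ℕ) : ℝ) - R) / R = ((t - 1 : ℕ) : ℝ) + 1 / R := by
    push_cast [ht]
    field_simp
    ring
  rw [mainTerm, h1, Real.rpow_add hq0, Real.rpow_natCast, rootQLn,
    Real.mul_rpow hq0.le (Real.log_pos hq).le, mul_assoc]

theorem thetaPG_pos (m : ℕ) (hq : 1 < q) : 0 < thetaPG m q :=
  div_pos (sub_pos.2 (one_lt_pow₀ hq (by omega))) (by linarith)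

theorem firstBound_lt_secondBound {t : ℕ} {c a : ℝ} (hR : R ≠ 0) (ht : 1 ≤ t) (ha : 1 < a)
    (haq : a ≤ q) : firstBound R t c q < secondBound R t c a q := by
  have hq : 1 < q := ha.trans_le haq
  have hq0 : 0 < q := by linarith
  have hR' : (0 : ℝ) < R := by positivity
  have hLa := rootQLn_pos (R := R) ha
  have hLaq : rootQLn R a ≤ rootQLn R q := (rootQLn_strictMonoOn hR).monotoneOn ha hq haq
  have h1 : q / (q - 1) ≤ a / (a - 1) := by
    rw [div_le_div_iff₀ (by linarith) (by linarith)]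
    linarith
  have h0 : 0 < q / (q - 1) := div_pos hq0 (by linarith)
  have hth : thetaPG (t - 1) q < q ^ (t - 1) * (q / (q - 1)) := by
    rw [thetaPG, mul_div_assoc', ← pow_succ]
    exact div_lt_div_of_pos_right (by linarith) (by linarith)
  have h2 : (2 + q / (q - 1)) ≤ (2 + a / (a - 1)) / rootQLn R a * rootQLn R q := by
    rw [div_mul_eq_mul_div, le_div_iff₀ hLa]
    exact mul_le_mul (by linarith) hLaq hLa.le (by linarith)
  rw [firstBound, secondBound, mainTerm_eq hR ht hq]
  have h3 : (R : ℝ) * thetaPG (t - 1) q < R * (q ^ (t - 1) * (q / (q - 1))) :=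
    mul_lt_mul_of_pos_left hth hR'
  have h4 : (R : ℝ) * (q ^ (t - 1) * (2 + q / (q - 1))) ≤
      R * (q ^ (t - 1) * ((2 + a / (a - 1)) / rootQLn R a * rootQLn R q)) := by gcongr
  nlinarith

end Functions

/-! ### Size of the covering families -/

section Core

open Filter Topology

variable {R : ℕ} {lam q : ℝ}

/-- The coefficient of `(q ln q) ^ (1 / R)` that the greedy construction yields. It is smaller than
`Ω_{λ,R}(q)`, having `(R + 1) (R - 1)!` in place of `R R!`, and tends to a limit smaller than
`D_{λ,R}`. -/
noncomputable def greedyConst (lam : ℝ) (R : ℕ) (q : ℝ) : ℝ :=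
  lam + ((R : ℝ) + 1) * ((R - 1).factorial : ℝ) / betaFn lam R q ^ (R - 1)
    * (2 / (2 - 1 / q - upsilonFn lam R q))

theorem succ_mul_factorial_lt (hR : 2 ≤ R) :
    ((R : ℝ) + 1) * ((R - 1).factorial : ℝ) < (R : ℝ) * (R.factorial : ℝ) := by
  obtain ⟨k, rfl⟩ : ∃ k, R = k + 1 := ⟨R - 1, by omega⟩
  have hk : (1 : ℝ) ≤ k := by exact_mod_cast (by omega : 1 ≤ k)
  have hf : (0 : ℝ) < (k.factorial : ℝ) := by positivity
  rw [Nat.add_sub_cancel, Nat.factorial_succ]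
  push_cast
  rw [← mul_assoc]
  exact mul_lt_mul_of_pos_right (by nlinarith) hf

theorem greedyConst_le_omegaFn (hR : 2 ≤ R) (hq : 1 < q) (hb : 0 < betaFn lam R q)
    (hU : upsilonFn lam R q ≤ 1) : greedyConst lam R q ≤ omegaFn lam R q := by
  have hd := two_sub_pos hq hU
  have h := succ_mul_factorial_lt hR
  rw [greedyConst, omegaFn]
  gcongr

theorem eventually_greedyConst_le_Dlam (hR : 2 ≤ R) (hlam : 0 < lam) :
    ∀ᶠ q : ℝ in atTop, greedyConst lam R q ≤ Dlam lam R := by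
  have h1 : Tendsto (greedyConst lam R) atTop
      (𝓝 (lam + ((R : ℝ) + 1) * ((R - 1).factorial : ℝ) / lam ^ (R - 1) * (2 / (2 - 0 - 0)))) := by
    have hinv : Tendsto (fun q : ℝ => 1 / q) atTop (𝓝 0) := by
      simpa using tendsto_inv_atTop_zero (𝕜 := ℝ)
    refine tendsto_const_nhds.add (Tendsto.mul
      (tendsto_const_nhds.div ((tendsto_betaFn (by omega)).pow _) (by positivity))
      (tendsto_const_nhds.div ((tendsto_const_nhds.sub hinv).sub (tendsto_upsilonFn (by omega)))
        (by norm_num)))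
  refine (h1.eventually_lt_const ?_).mono fun _ h => h.le
  rw [Dlam, add_lt_add_iff_left]
  norm_num
  exact div_lt_div_of_pos_right (succ_mul_factorial_lt hR) (by positivity)

/-- In `F ^ (R + 1)` there is a family of at most `c L + R` vectors that covers with `R` of them,
where `L ^ R = q ln q` and `c` is `greedyConst lam R q`. -/
theorem exists_coversWith_card_le {F : Type u} [Field F] [Fintype F] (hR : 2 ≤ R) (hlam : 0 < lam)
    (hqF : q = Fintype.card F) (hb : 0 < betaFn lam R q) (hU : upsilonFn lam R q ≤ 1) :
    ∃ (n : ℕ) (h : Fin n → Fin (R + 1) → F), CoversWith F h R ∧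
      (n : ℝ) ≤ greedyConst lam R q * rootQLn R q + R := by
  classical
  have hq : 1 < q := by rw [hqF]; exact_mod_cast Fintype.one_lt_card
  have hq0 : 0 < q := by linarith
  have hlog := Real.log_pos hq
  have hL := rootQLn_pos (R := R) hq
  have hLR := rootQLn_pow (R := R) (by omega) hq
  have hUq := upsilonFn_mul (lam := lam) (R := R) (by omega) hq
  have hd := two_sub_pos hq hU
  have hbL : betaFn lam R q * rootQLn R q = lam * rootQLn R q - ((R : ℝ) - 1) := by
    rw [betaFn, sub_mul, div_mul_cancel₀ _ hL.ne']
  have hbLpos := mul_pos hb hL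
  obtain ⟨k, rfl⟩ : ∃ k, R = k + 1 := ⟨R - 1, by omega⟩
  have hcast : (((k + 1 : ℕ) : ℝ) - 1) = k := by push_cast; ring
  simp only [Nat.add_sub_cancel] at hUq
  rw [hcast] at hbL
  rw [greedyConst]
  simp only [Nat.add_sub_cancel]
  set L := rootQLn (k + 1) q
  set β := betaFn lam (k + 1) q
  set U := upsilonFn lam (k + 1) q with hUdef
  set D := 2 - 1 / q - U with hD
  have hlamL : 0 < lam * L := mul_pos hlam hL
  set w := ⌊lam * L⌋₊ with hw
  have hwle : (w : ℝ) ≤ lam * L := Nat.floor_le hlamL.le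
  have hwlt : lam * L < w + 1 := Nat.lt_floor_add_one _
  by_cases hwq : Fintype.card F < w
  · -- more points than the rational normal curve has: a line and a complementary basis suffice
    obtain ⟨h, hh⟩ := exists_coversWith_line (F := F) k
    refine ⟨_, _, hh.reindex (Fintype.equivFin _).symm, ?_⟩
    have h1 : q < w := by rw [hqF]; exact_mod_cast hwq
    have h2 : 0 ≤ (((k + 1 : ℕ) : ℝ) + 1) * (k.factorial : ℝ) / β ^ k * (2 / D) * L := by positivity
    simp only [Fintype.card_sum, Fintype.card_fin]
    push_cast at h2 ⊢
    rw [← hqF]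
    nlinarith
  · push Not at hwq
    have ⟨a⟩ : Nonempty (Fin w ↪ F) :=
      Function.Embedding.nonempty_of_card_le (by simpa using hwq)
    set m : ℝ := (w.choose k : ℝ) with hm
    set x : ℝ := (β * L) ^ k / (k.factorial : ℝ) with hx
    have hx0 : 0 < x := by positivity
    have hxm : x ≤ m := by
      refine le_trans ?_ (Nat.pow_le_choose (α := ℝ) k w)
      have hkw : k ≤ w + 1 := by
        have : (k : ℝ) < w + 1 := by linarith
        exact_mod_cast this.le
      have h1 : β * L ≤ ((w + 1 - k : ℕ) : ℝ) := by
        push_cast [hkw]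
        linarith
      rw [hx]
      gcongr
    have hmU : m ≤ U * q := by
      rw [hUq]
      refine (Nat.choose_le_pow_div (α := ℝ) k w).trans ?_
      gcongr
    have hDq : D * q = 2 * q - 1 - U * q := by
      rw [hD]; field_simp
    -- a lower bound for the proportion of vectors whose addition covers a given uncovered vector
    set p : ℝ := x / q * (D / 2) with hp
    have hp0 : 0 < p := by positivity
    have hp1 : p ≤ 1 := by
      have h1 : x / q ≤ 1 := by
        rw [div_le_one hq0]
        nlinarith
      have h2 : D / 2 ≤ 1 := by
        have := upsilonFn_pos (R := k + 1) hlam hq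
        have : 0 < 1 / q := by positivity
        rw [hD]
        linarith
      exact mul_le_one₀ h1 (by positivity) h2
    -- the least `N` for which `q ^ (k + 2) * exp (-p N) < 1`
    set N : ℕ := ⌊((k : ℝ) + 2) * Real.log q / p⌋₊ + 1 with hN
    have hNlt : ((k : ℝ) + 2) * Real.log q < p * N := by
      have := Nat.lt_floor_add_one (((k : ℝ) + 2) * Real.log q / p)
      rw [div_lt_iff₀ hp0] at this
      rw [hN]
      push_cast
      linarith
    have hNle : (N : ℝ) ≤ ((k : ℝ) + 2) * Real.log q / p + 1 := by
      rw [hN]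
      push_cast
      linarith [Nat.floor_le (by positivity : 0 ≤ ((k : ℝ) + 2) * Real.log q / p)]
    have hV : (Fintype.card (Fin (k + 1 + 1) → F) : ℝ) = q ^ (k + 2) := by
      simp [hqF]
    have hpm : p * q ^ (k + 2) ≤ m * (q ^ (k + 1) - q ^ k) - m * (m - 1) / 2 * q ^ k := by
      have h1 : p * q ^ (k + 2) = x * (D * q) / 2 * q ^ k := by
        rw [hp, pow_add q k 2]
        field_simp
      have h2 : m * (q ^ (k + 1) - q ^ k) - m * (m - 1) / 2 * q ^ k =
          m * (2 * q - 1 - m) / 2 * q ^ k := by ring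
      rw [h1, h2, hDq]
      have h3 : 0 < 2 * q - 1 - U * q := by rw [← hDq]; positivity
      gcongr
    have hpN : (1 - p) ^ N * q ^ (k + 2) < 1 := by
      have h1 : (1 - p) ^ N ≤ Real.exp (-(p * N)) := by
        calc (1 - p) ^ N ≤ Real.exp (-p) ^ N :=
              pow_le_pow_left₀ (by linarith) (Real.one_sub_le_exp_neg p) N
          _ = _ := by rw [← Real.exp_nat_mul]; ring_nf
      have h2 : q ^ (k + 2) = Real.exp (((k : ℝ) + 2) * Real.log q) := by
        rw [mul_comm, Real.exp_mul, Real.exp_log hq0]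
        exact_mod_cast rfl
      calc (1 - p) ^ N * q ^ (k + 2)
          ≤ Real.exp (-(p * N)) * Real.exp (((k : ℝ) + 2) * Real.log q) := by
            rw [h2]; exact mul_le_mul_of_nonneg_right h1 (Real.exp_pos _).le
        _ < 1 := by
            rw [← Real.exp_add, Real.exp_lt_one_iff]
            linarith
    obtain ⟨h, hh⟩ := exists_coversWith_of_arc (F := F) (V := Fin (k + 1 + 1) → F) (k := k) (N := N)
      (fun T hT => linearIndepOn_pow (n := k + 1 + 1) a.injective T (by omega)) (m := m) (p := p)
      (by rw [Fintype.card_fin]) hp1 (by rwa [hV, ← hqF]) (by rwa [hV])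
    refine ⟨_, _, hh.reindex (Fintype.equivFin _).symm, ?_⟩
    have hkey : ((k : ℝ) + 2) * Real.log q / p =
        (((k + 1 : ℕ) : ℝ) + 1) * (k.factorial : ℝ) / β ^ k * (2 / D) * L := by
      have h1 : q * Real.log q = L ^ k * L := by rw [← hLR, pow_succ]
      rw [hp, hx]
      push_cast
      field_simp
      linear_combination (k + 2 : ℝ) * β ^ k * h1
    rw [hkey] at hNle
    simp only [Fintype.card_sum, Fintype.card_fin]
    push_cast at hNle ⊢
    have : (0 : ℝ) ≤ k := by positivity
    nlinarith

/-- The upper bound on the length function for any coefficient `c` not below the one of the greedy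
construction. -/
theorem lengthFunction_lt_firstBound {F : Type u} [Field F] [Fintype F] {t : ℕ} {c : ℝ}
    (hR : 2 ≤ R) (hlam : 0 < lam) (hqF : q = Fintype.card F) (hb : 0 < betaFn lam R q)
    (hU : upsilonFn lam R q ≤ 1) (hc : greedyConst lam R q ≤ c) (ht : 1 ≤ t)
    (hcq : 2 ≤ t → c * rootQLn R q + 2 * (R : ℝ) ≤ q + 1) :
    (lengthFunction F (t * R + 1) R : ℝ) < firstBound R t c q := by
  have hq : 1 < q := by rw [hqF]; exact_mod_cast Fintype.one_lt_card
  have hL := rootQLn_pos (R := R) hq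
  obtain ⟨n, h, hh, hn⟩ := exists_coversWith_card_le (F := F) hR hlam hqF hb hU
  have hnc : (n : ℝ) ≤ c * rootQLn R q + R := hn.trans (by gcongr)
  have hR' : (2 : ℝ) ≤ R := by exact_mod_cast hR
  have h1 := lengthFunction_le_of_coversWith_lift ht hh fun ht2 => by
    have := hcq ht2
    have h2 : (n : ℝ) ≤ Fintype.card F := by rw [← hqF]; linarith
    simpa using (by exact_mod_cast h2 : n ≤ Fintype.card F)
  have h2 : (lengthFunction F (t * R + 1) R : ℝ) ≤ (n + R) * q ^ (t - 1) := by
    rw [hqF]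
    rw [Fintype.card_fin] at h1
    exact_mod_cast h1
  have h3 : 0 < (R : ℝ) * thetaPG (t - 1) q := mul_pos (by linarith) (thetaPG_pos _ hq)
  have h4 : ((n : ℝ) + R) * q ^ (t - 1) ≤ (c * rootQLn R q + 2 * R) * q ^ (t - 1) :=
    mul_le_mul_of_nonneg_right (by linarith) (pow_nonneg (by linarith) _)
  rw [firstBound, mainTerm_eq (by omega) ht hq]
  linarith

/-- For large `q` the coefficient may be taken to be `D_{λ,R}`, for all `t` at once. -/
theorem exists_lengthFunction_lt_Dlam (hR : 3 ≤ R) (hlam : 0 < lam) :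
    ∃ q₁ : ℕ, ∀ (q : ℕ) (F : Type u) [Field F] [Fintype F], Fintype.card F = q → q₁ < q →
      ∀ t : ℕ, 1 ≤ t →
        (lengthFunction F (t * R + 1) R : ℝ) < firstBound R t (Dlam lam R) q ∧
        firstBound R t (Dlam lam R) q < secondBound R t (Dlam lam R) q q := by
  have h := (((eventually_greedyConst_le_Dlam (R := R) (by omega) hlam).and
    ((tendsto_betaFn (lam := lam) (R := R) (by omega)).eventually_const_lt hlam)).and
    ((tendsto_upsilonFn (lam := lam) (R := R) (by omega)).eventually_le_const zero_lt_one)).and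
    (eventually_mul_rootQLn_add_le hR (Dlam lam R) (2 * R))
  obtain ⟨q₁, hq₁⟩ := eventually_atTop.1 (tendsto_natCast_atTop_atTop.eventually h)
  refine ⟨q₁, fun q F _ _ hqF hq t ht => ?_⟩
  obtain ⟨⟨⟨hc, hb⟩, hU⟩, hcq⟩ := hq₁ q hq.le
  have h1 : (1 : ℝ) < q := by rw [← hqF]; exact_mod_cast Fintype.one_lt_card
  exact ⟨lengthFunction_lt_firstBound (by omega) hlam (by rw [hqF]) hb hU hc ht fun _ => hcq,
    firstBound_lt_secondBound (by omega) ht h1 le_rfl⟩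

/-- The coefficient `3.43 R`, from `D_{R,R} ≤ 2 R`. -/
theorem exists_lengthFunction_lt_mul_mainTerm (hR : 3 ≤ R) :
    ∃ q₁ : ℕ, ∀ (q : ℕ) (F : Type u) [Field F] [Fintype F], Fintype.card F = q → q₁ < q →
      ∀ t : ℕ, 1 ≤ t →
        (lengthFunction F (t * R + 1) R : ℝ) < 3.43 * (R : ℝ) * mainTerm R (t * R + 1) q := by
  have hR0 : (0 : ℝ) < R := by exact_mod_cast (by omega : 0 < R)
  obtain ⟨q₁, hq₁⟩ := exists_lengthFunction_lt_Dlam.{u} hR hR0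
  obtain ⟨q₂, hq₂⟩ := eventually_atTop.1 (tendsto_natCast_atTop_atTop.eventually
    ((tendsto_rootQLn (R := R) (by omega)).eventually_ge_atTop 4))
  refine ⟨max q₁ q₂, fun q F _ _ hqF hq t ht => ?_⟩
  obtain ⟨h1, h2⟩ := hq₁ q F hqF ((le_max_left _ _).trans_lt hq) t ht
  refine (h1.trans h2).trans_le ?_
  have hL := hq₂ q ((le_max_right _ _).trans hq.le)
  have hq2 : (2 : ℝ) ≤ q := by rw [← hqF]; exact_mod_cast Fintype.one_lt_card (α := F)
  have h3 : (q : ℝ) / (q - 1) ≤ 2 := by rw [div_le_iff₀ (by linarith)]; linarith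
  have h4 : (2 + (q : ℝ) / (q - 1)) / rootQLn R q ≤ 1 := by
    rw [div_le_one (by linarith)]; linarith
  rw [secondBound]
  refine mul_le_mul_of_nonneg_right ?_ ?_
  · have := Dlam_self_le (R := R) (by omega)
    nlinarith
  · rw [mainTerm_eq (by omega) ht (by linarith)]
    have : 0 < rootQLn R (q : ℝ) := by linarith
    positivity

end Core

/-! ### Existence of the minima and the upper bounds -/

theorem theorem3p2 (R : ℕ) (hR : 3 ≤ R) :
    -- the two minima exist and agree
    (∀ (F : Type u) [Field F] [Fintype F] (t : ℕ), 1 ≤ t →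
      (codeLengths F (t * R + 1) R).Nonempty ∧
      (saturatingSizes F (t * R) (R - 1)).Nonempty ∧
      lengthFunction F (t * R + 1) R = smallestSaturating F (t * R) (R - 1)) ∧
    (∀ lam : ℝ, 0 < lam → 0 < betaFn lam R (Qlam lam R) →
      -- (i) upper bounds by a decreasing function
      (StrictAntiOn (omegaFn lam R) (Set.Ioi (Qlam lam R : ℝ)) ∧
        (∀ x : ℝ, (Qlam lam R : ℝ) < x → omegaFn lam R x < Clam lam R) ∧
        (∀ (q : ℕ) (F : Type u) [Field F] [Fintype F], Fintype.card F = q → Qlam lam R < q →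
          ∀ t : ℕ, 1 ≤ t →
            (2 ≤ t → Clam lam R * rootQLn R q + 2 * (R : ℝ) ≤ (q : ℝ) + 1) →
            (lengthFunction F (t * R + 1) R : ℝ) < firstBound R t (omegaFn lam R q) q ∧
            firstBound R t (omegaFn lam R q) q < secondBound R t (omegaFn lam R q) q q)) ∧
      -- (ii) upper bounds by constants
      (∀ Q₀ : ℝ, (Qlam lam R : ℝ) < Q₀ →
        omegaFn lam R Q₀ < Clam lam R ∧ Dlam lam R < omegaFn lam R Q₀ ∧
        ∀ c q₀ : ℝ,
          (c = Clam lam R ∧ q₀ = (Qlam lam R : ℝ)) ∨ (c = omegaFn lam R Q₀ ∧ q₀ = Q₀) →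
          ∀ (q : ℕ) (F : Type u) [Field F] [Fintype F], Fintype.card F = q → q₀ < (q : ℝ) →
            ∀ t : ℕ, 1 ≤ t →
              (2 ≤ t → c * rootQLn R q + 2 * (R : ℝ) ≤ (q : ℝ) + 1) →
              (lengthFunction F (t * R + 1) R : ℝ) < firstBound R t c q ∧
              firstBound R t c q < secondBound R t c q₀ q)) ∧
    -- (iii) asymptotic upper bounds
    (∀ c : ℝ, (c = Dmin R ∨ ∃ lam : ℝ, 0 < lam ∧ c = Dlam lam R) →
      ∃ q₁ : ℕ, ∀ (q : ℕ) (F : Type u) [Field F] [Fintype F], Fintype.card F = q → q₁ < q →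
        ∀ t : ℕ, 1 ≤ t →
          (lengthFunction F (t * R + 1) R : ℝ) < firstBound R t c q ∧
          firstBound R t c q < secondBound R t c q q) ∧
    (∃ q₁ : ℕ, ∀ (q : ℕ) (F : Type u) [Field F] [Fintype F], Fintype.card F = q → q₁ < q →
      ∀ t : ℕ, 1 ≤ t →
        (lengthFunction F (t * R + 1) R : ℝ) < 3.43 * (R : ℝ) * mainTerm R (t * R + 1) q) := by
  refine ⟨fun F _ _ t ht => ?_, fun lam hlam hb => ⟨⟨omegaFn_strictAntiOn (by omega) hlam hb,
    fun x hx => omegaFn_lt_Clam (by omega) hlam hb hx, ?_⟩, fun Q₀ hQ₀ =>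
      ⟨omegaFn_lt_Clam (by omega) hlam hb hQ₀, ?_, ?_⟩⟩, ?_,
    exists_lengthFunction_lt_mul_mainTerm hR⟩
  · have htR : R ≤ t * R := Nat.le_mul_of_pos_left R ht
    have h := lengthFunction_eq_smallestSaturating (F := F) (N := t * R) (ρ := R - 1) (by omega)
    rw [Nat.sub_add_cancel (by omega)] at h
    exact ⟨codeLengths_nonempty (by omega) (by omega), saturatingSizes_nonempty (by omega), h⟩
  · intro q F _ _ hqF hq t ht hcond
    have hQ := one_lt_Qlam (R := R) (by omega) hlam
    have hq' : (Qlam lam R : ℝ) < q := by exact_mod_cast hq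
    have hbq := hb.trans (betaFn_strictMonoOn (by omega) hQ (hQ.trans hq') hq')
    have hU := upsilonFn_le_one (R := R) (by omega) hlam hq'
    refine ⟨lengthFunction_lt_firstBound (by omega) hlam (by rw [hqF]) hbq hU
      (greedyConst_le_omegaFn (by omega) (hQ.trans hq') hbq hU) ht fun ht2 => ?_,
      firstBound_lt_secondBound (by omega) ht (hQ.trans hq') le_rfl⟩
    have h1 := (mul_lt_mul_of_pos_right (omegaFn_lt_Clam (by omega) hlam hb hq')
      (rootQLn_pos (R := R) (hQ.trans hq'))).le
    linarith [hcond ht2]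
  · have hQ := one_lt_Qlam (R := R) (by omega) hlam
    exact Dlam_lt_omegaFn (by omega) hlam (hQ.trans hQ₀)
      (hb.trans (betaFn_strictMonoOn (by omega) hQ (hQ.trans hQ₀) hQ₀))
      (upsilonFn_le_one (by omega) hlam hQ₀)
  · intro c q₀ hc q F _ _ hqF hq t ht hcond
    have hQ := one_lt_Qlam (R := R) (by omega) hlam
    have hQq₀ : (Qlam lam R : ℝ) ≤ q₀ := by
      rcases hc with ⟨-, rfl⟩ | ⟨-, rfl⟩
      · exact le_rfl
      · exact hQ₀.le
    have hq' : (Qlam lam R : ℝ) < q := hQq₀.trans_lt hq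
    have hcΩ : omegaFn lam R q ≤ c := by
      rcases hc with ⟨rfl, rfl⟩ | ⟨rfl, rfl⟩
      · exact (omegaFn_lt_Clam (by omega) hlam hb hq).le
      · exact (omegaFn_strictAntiOn (by omega) hlam hb hQ₀ hq' hq).le
    have hbq := hb.trans (betaFn_strictMonoOn (by omega) hQ (hQ.trans hq') hq')
    have hU := upsilonFn_le_one (R := R) (by omega) hlam hq'
    exact ⟨lengthFunction_lt_firstBound (by omega) hlam (by rw [hqF]) hbq hU
      ((greedyConst_le_omegaFn (by omega) (hQ.trans hq') hbq hU).trans hcΩ) ht hcond,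
      firstBound_lt_secondBound (by omega) ht (hQ.trans_le hQq₀) hq.le⟩
  · rintro c (rfl | ⟨lam, hlam, rfl⟩)
    · obtain ⟨lam, hlam, h⟩ := Dmin_eq_Dlam (R := R) (by omega)
      rw [h]
      exact exists_lengthFunction_lt_Dlam hR hlam
    · exact exists_lengthFunction_lt_Dlam hR hlam
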